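/- Let $m\ge 1$, let $p=(p_1,\dots,p_m)$ be a probability vector with all $p_i>0$, and equip $\mathcal I=\{1,\dots,m\}^{\mathbb N}$ with the corresponding Bernoulli (product) measure, also denoted $p$. For each $i\in\{1,\dots,m\}$ let $m_i\ge 1$, and $m_{ij}\ge 1$ for $1\le j\le m_i$, be integers, let $\mathcal J_i=\{(j,k): 1\le j\le m_i,\ 1\le k\le m_{ij}\}$, and for $(j,k)\in\mathcal J_i$ let $$A_{ijk}(x,y)=(a_{ijk}x+c_{ijk},\ b_{ij}y+d_{ij}),$$ where $0<a_{ijk}\le b_{ij}<1$, $\sum_j b_{ij}\le 1$, $\sum_k a_{ijk}\le 1$; $0\le d_{i1}<\dots<d_{im_i}<1$ with $d_{i(j+1)}-d_{ij}\ge b_{ij}$ and $1-d_{im_i}\ge b_{im_i}$; and $0\le c_{ij1}<\dots<c_{ijm_{ij}}<1$ with $c_{ij(k+1)}-c_{ijk}\ge a_{ijk}$ and $1-c_{ijm_{ij}}\ge a_{ijm_{ij}}$. For $\mathbf i=(i_1,i_2,\dots)\in\mathcal I$ put $$\Lambda_{\mathbf i}=\bigcap_{n=1}^\infty\ \bigcup_{\omega_1\in\mathcal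 J_{i_1},\dots,\omega_n\in\mathcal J_{i_n}} A_{i_1\omega_1}\circ\cdots\circ A_{i_n\omega_n}([0,1]^2).$$ Let $\mathcal W$ be the set of all collections $P=(p_{ij})$ of non-negative numbers with $\sum_{j=1}^{m_i}p_{ij}=p_i$ for every $i$. For $P\in\mathcal W$ let (with $0\log 0=0$) $$\lambda(P)=\frac{\sum_{i,j}p_{ij}\log p_{ij}-\sum_i p_i\log p_i}{\sum_{i,j}p_{ij}\log b_{ij}},$$ and let $t(P)$ be the unique number in $[0,1]$ with $\sum_{i,j}p_{ij}\log\bigl(\sum_k a_{ijk}^{t(P)}\bigr)=0$. For $\mathbf i\in\mathcal I$ let $\tilde\mu_{P,\mathbf i}$ be the product probability measure on $\prod_{n\ge1}\mathcal J_{i_n}$ that gives the digit $(j,k)$ at the $n$-th place the probability $$\frac{p_{i_nj}}{p_{i_n}}\cdot\frac{a_{i_njk}^{t(P)}}{\sum_{k'}a_{i_njk'}^{t(P)}},$$ and let the Bernoulli measure $\mu_{P,\mathbf i}$ be its image under the map sending $\omega$ to the unique point of $\bigcap_{n} A_{i_1\omega_1}\circ\cdots\circ A_{i_n\omega_n}([0,1]^2)$.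 For a Borel probability measure $\mu$ on $\mathbb R^2$ let $\dim_H\mu=\inf\{\dim_H F: F \text{ Borel},\ \mu(F)=1\}$. Consider the following hypotheses. 1. For each $t\in[0,1]$ there are $i$ and $j<j'\le m_i$ with $\sum_k a_{ijk}^t\neq\sum_k a_{ij'k}^t$. 2. (for a given $\varepsilon>0$) For each $i$ there are numbers $0<a_i\le b_i<1$ such that $(1+\varepsilon)^{-1}<b_{ij}/b_i<1+\varepsilon$ and $(1+\varepsilon)^{-1}<a_{ijk}/a_i<1+\varepsilon$ for all $(j,k)\in\mathcal J_i$. 3. (for a given $\varepsilon>0$) $b_{ij}/a_{ijk}<1+\varepsilon$ for all $i$ and all $(j,k)\in\mathcal J_i$. **Corollary A.** There is an $\varepsilon>0$ such that, whenever hypothesis 1 holds together with hypothesis 2 or hypothesis 3 for this $\varepsilon$, there is a single vector $P^*\in\mathcal W$, at which $P\mapsto\lambda(P)+t(P)$ attains its maximum over $\mathcal W$, such that $$\dim_H\Lambda_{\mathbf i}=\dim_H\mu_{P^*,\mathbf i}=\lambda(P^*)+t(P^*)\qquad\text{for } p\text{-a.e. }\mathbf i\in\mathcal I .$$ -/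

import Mathlib

open MeasureTheory

/-- The data of a random self-affine Sierpiński carpet: finitely many families, indexed by
`i : Fin m`, of planar affine contractions
`(x, y) ↦ (a i j k * x + c i j k, b i j * y + d i j)`, the maps of the family `i` being arranged in
`rows i` rows, with `cols i j` maps in the row `j`, and a positive probability vector `p` according
to which the family is chosen independently at each step. All indices start at `0`. -/
structure RandomCarpet where
  m : ℕ
  p : Fin m → ℝ
  p_pos : ∀ i, 0 < p i
  p_sum : ∑ i, p i = 1
  rows : Fin m → ℕ
  rows_pos : ∀ i, 0 < rows i
  cols : (i : Fin m) → Fin (rows i) → ℕ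
  cols_pos : ∀ i j, 0 < cols i j
  a : (i : Fin m) → (j : Fin (rows i)) → Fin (cols i j) → ℝ
  b : (i : Fin m) → Fin (rows i) → ℝ
  c : (i : Fin m) → (j : Fin (rows i)) → Fin (cols i j) → ℝ
  d : (i : Fin m) → Fin (rows i) → ℝ
  a_pos : ∀ i j k, 0 < a i j k
  a_le_b : ∀ i j k, a i j k ≤ b i j
  b_lt_one : ∀ i j, b i j < 1
  b_sum : ∀ i, ∑ j, b i j ≤ 1
  a_sum : ∀ i j, ∑ k, a i j k ≤ 1
  d_nonneg : ∀ i j, 0 ≤ d i j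
  d_lt_one : ∀ i j, d i j < 1
  d_strictMono : ∀ i, StrictMono (d i)
  d_gap : ∀ i (j j' : Fin (rows i)), (j : ℕ) + 1 = j' → b i j ≤ d i j' - d i j
  d_last : ∀ i (j : Fin (rows i)), (j : ℕ) + 1 = rows i → b i j ≤ 1 - d i j
  c_nonneg : ∀ i j k, 0 ≤ c i j k
  c_lt_one : ∀ i j k, c i j k < 1
  c_strictMono : ∀ i j, StrictMono (c i j)
  c_gap : ∀ i j (k k' : Fin (cols i j)), (k : ℕ) + 1 = k' → a i j k ≤ c i j k' - c i j k
  c_last : ∀ i j (k : Fin (cols i j)), (k : ℕ) + 1 = cols i j → a i j k ≤ 1 - c i j k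

/-- The weighted sum of point masses on a finite type with weights `w`. -/
noncomputable def weightedMeasure {α : Type} [Fintype α] [MeasurableSpace α] (w : α → ℝ) :
    Measure α :=
  ∑ x, ENNReal.ofReal (w x) • Measure.dirac x

theorem isProbabilityMeasure_weightedMeasure {α : Type} [Fintype α] [MeasurableSpace α]
    (w : α → ℝ) (h0 : ∀ x, 0 ≤ w x) (h1 : ∑ x, w x = 1) :
    IsProbabilityMeasure (weightedMeasure w) := by
  constructor
  simp only [weightedMeasure, Measure.coe_finsetSum, Finset.sum_apply, Measure.smul_apply,
    measure_univ, smul_eq_mul, mul_one]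
  rw [← ENNReal.ofReal_sum_of_nonneg (fun x _ => h0 x), h1, ENNReal.ofReal_one]

/-- The Hausdorff dimension of a Borel probability measure `μ`: the infimum of the Hausdorff
dimensions of the Borel sets of full measure. -/
noncomputable def measureDimH {X : Type*} [EMetricSpace X] [MeasurableSpace X] (μ : Measure X) :
    ENNReal :=
  ⨅ (F : Set X) (_ : MeasurableSet F) (_ : μ F = 1), dimH F

/-- The closed unit square in the Euclidean plane. -/
def unitSquare : Set (EuclideanSpace ℝ (Fin 2)) := {x | ∀ l, x l ∈ Set.Icc (0 : ℝ) 1}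

namespace RandomCarpet

variable (S : RandomCarpet)

/-- The finite index set of the maps of the family `i`, that is, the pairs `(j, k)`. -/
abbrev Digit (i : Fin S.m) : Type := (j : Fin (S.rows i)) × Fin (S.cols i j)

instance discreteMeasurableSpace_digit (i : Fin S.m) : DiscreteMeasurableSpace (S.Digit i) :=
  ⟨fun _ => MeasurableSpace.measurableSet_iInf.2 fun j =>
    MeasurableSpace.map_def.2 (MeasurableSet.of_discrete (α := Fin (S.cols i j)))⟩

/-- The affine map with index `(i, j, k)`. -/
noncomputable def affMap (i : Fin S.m) (q : S.Digit i) (x : EuclideanSpace ℝ (Fin 2)) :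
    EuclideanSpace ℝ (Fin 2) :=
  !₂[S.a i q.1 q.2 * x 0 + S.c i q.1 q.2, S.b i q.1 * x 1 + S.d i q.1]

/-- The composition of the first `n` maps along the digit sequence `ω`, the first map being the
outermost one. -/
noncomputable def compMap (i : ℕ → Fin S.m) (ω : ∀ n, S.Digit (i n)) :
    ℕ → EuclideanSpace ℝ (Fin 2) → EuclideanSpace ℝ (Fin 2)
  | 0 => id
  | n + 1 => compMap i ω n ∘ S.affMap (i n) (ω n)

/-- The basic rectangle of order `n` of the digit sequence `ω`. -/
noncomputable def rect (i : ℕ → Fin S.m) (ω : ∀ n, S.Digit (i n)) (n : ℕ) :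
    Set (EuclideanSpace ℝ (Fin 2)) :=
  S.compMap i ω n '' unitSquare

/-- The random set of the environment `i`: the intersection over `n ≥ 1` of the unions of all basic
rectangles of order `n`. (As the basic rectangle of order `n` of `ω` only depends on the
first `n` digits, and each finite word of digits extends to an infinite one, this is the union over
the finite words of length `n`.) -/
noncomputable def limitSet (i : ℕ → Fin S.m) : Set (EuclideanSpace ℝ (Fin 2)) :=
  ⋂ n : ℕ, ⋃ ω : ∀ n, S.Digit (i n), S.rect i ω (n + 1)

/-- The Bernoulli measure on the environments. -/
noncomputable def envMeasure : Measure (ℕ → Fin S.m) :=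
  Measure.infinitePi (fun _ => weightedMeasure S.p)

/-- The generic hypothesis: for each exponent `t` in `[0, 1]` some family has two rows with different
sums of `t`-th powers of the widths. -/
def Generic : Prop :=
  ∀ t ∈ Set.Icc (0 : ℝ) 1, ∃ (i : Fin S.m) (j j' : Fin (S.rows i)), j < j' ∧
    ∑ k, S.a i j k ^ t ≠ ∑ k, S.a i j' k ^ t

/-- The first robust hypothesis: within each family all heights are nearly equal and all widths
are nearly equal. -/
def NearlyConstant (ε : ℝ) : Prop :=
  ∀ i, ∃ a' b' : ℝ, 0 < a' ∧ a' ≤ b' ∧ b' < 1 ∧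
    ∀ (j : Fin (S.rows i)) (k : Fin (S.cols i j)),
      ((1 + ε)⁻¹ < S.b i j / b' ∧ S.b i j / b' < 1 + ε) ∧
      ((1 + ε)⁻¹ < S.a i j k / a' ∧ S.a i j k / a' < 1 + ε)

/-- The second robust hypothesis: all maps are nearly conformal. -/
def NearlyConformal (ε : ℝ) : Prop :=
  ∀ (i : Fin S.m) (j : Fin (S.rows i)) (k : Fin (S.cols i j)), S.b i j / S.a i j k < 1 + ε

/-- The vectors `P` over the index pairs `(i, j)` that project onto `p`. -/
def weights : Set ((i : Fin S.m) → Fin (S.rows i) → ℝ) :=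
  {P | (∀ i j, 0 ≤ P i j) ∧ ∀ i, ∑ j, P i j = S.p i}

/-- The dimension `λ(P)` in the vertical direction. -/
noncomputable def baseDim (P : S.weights) : ℝ :=
  (∑ i, ∑ j, P.1 i j * Real.log (P.1 i j) - ∑ i, S.p i * Real.log (S.p i)) /
    ∑ i, ∑ j, P.1 i j * Real.log (S.b i j)

theorem rowSum_pos (t : ℝ) (i : Fin S.m) (j : Fin (S.rows i)) : 0 < ∑ k, S.a i j k ^ t :=
  Finset.sum_pos (fun k _ => Real.rpow_pos_of_pos (S.a_pos i j k) t)
    ⟨⟨0, S.cols_pos i j⟩, Finset.mem_univ _⟩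

/-- The equation that determines `t(P)` has exactly one solution in `[0, 1]`. -/
theorem existsUnique_fibreDim (P : S.weights) :
    ∃! t : ℝ, t ∈ Set.Icc (0 : ℝ) 1 ∧
      ∑ i, ∑ j, P.1 i j * Real.log (∑ k, S.a i j k ^ t) = 0 := by
  obtain ⟨P, hP0, hP1⟩ := P
  simp only
  have hcont : Continuous fun t : ℝ => ∑ i, ∑ j, P i j * Real.log (∑ k, S.a i j k ^ t) := by
    refine continuous_finsetSum _ fun i _ => continuous_finsetSum _ fun j _ => ?_
    refine continuous_const.mul (Continuous.log ?_ fun t => (S.rowSum_pos t i j).ne')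
    exact continuous_finsetSum _ fun k _ =>
      Real.continuous_const_rpow (S.a_pos i j k).ne'
  have hlt : ∀ (s t : ℝ), s < t → ∀ i j,
      Real.log (∑ k, S.a i j k ^ t) < Real.log (∑ k, S.a i j k ^ s) := by
    intro s t hst i j
    refine Real.log_lt_log (S.rowSum_pos t i j) (Finset.sum_lt_sum_of_nonempty
      ⟨⟨0, S.cols_pos i j⟩, Finset.mem_univ _⟩ fun k _ => ?_)
    exact Real.rpow_lt_rpow_of_exponent_gt (S.a_pos i j k)
      ((S.a_le_b i j k).trans_lt (S.b_lt_one i j)) hst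
  have hanti : StrictAnti fun t : ℝ => ∑ i, ∑ j, P i j * Real.log (∑ k, S.a i j k ^ t) := by
    intro s t hst
    have hm : 0 < S.m := by
      rcases Nat.eq_zero_or_pos S.m with h | h
      · have : IsEmpty (Fin S.m) := by rw [h]; infer_instance
        simpa using S.p_sum
      · exact h
    refine Finset.sum_lt_sum_of_nonempty ⟨⟨0, hm⟩, Finset.mem_univ _⟩ fun i _ => ?_
    have hpos : ∃ j ∈ Finset.univ, 0 < P i j := by
      by_contra hcon
      push Not at hcon
      have h1 := Finset.sum_nonpos hcon
      rw [hP1 i] at h1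
      exact absurd (S.p_pos i) (not_lt.2 h1)
    obtain ⟨j, hj, hPj⟩ := hpos
    exact Finset.sum_lt_sum
      (fun j _ => mul_le_mul_of_nonneg_left (hlt s t hst i j).le (hP0 i j))
      ⟨j, hj, mul_lt_mul_of_pos_left (hlt s t hst i j) hPj⟩
  have h0 : 0 ≤ ∑ i, ∑ j, P i j * Real.log (∑ k, S.a i j k ^ (0 : ℝ)) := by
    refine Finset.sum_nonneg fun i _ => Finset.sum_nonneg fun j _ =>
      mul_nonneg (hP0 i j) (Real.log_nonneg ?_)
    simpa using Nat.one_le_iff_ne_zero.2 (S.cols_pos i j).ne'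
  have h1 : ∑ i, ∑ j, P i j * Real.log (∑ k, S.a i j k ^ (1 : ℝ)) ≤ 0 := by
    refine Finset.sum_nonpos fun i _ => Finset.sum_nonpos fun j _ =>
      mul_nonpos_of_nonneg_of_nonpos (hP0 i j)
        (Real.log_nonpos (S.rowSum_pos 1 i j).le ?_)
    simpa using S.a_sum i j
  obtain ⟨t, ht, ht0⟩ := intermediate_value_Icc' (zero_le_one' ℝ) hcont.continuousOn ⟨h1, h0⟩
  exact ⟨t, ⟨ht, ht0⟩, fun u hu => hanti.injective (hu.2.trans ht0.symm)⟩

/-- The dimension `t(P)` of the typical horizontal fibre. -/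
noncomputable def fibreDim (P : S.weights) : ℝ := (S.existsUnique_fibreDim P).choose

/-- The probability of the digit `(j, k)` at a step at which the family is `i`. -/
noncomputable def digitWeight (P : S.weights) (i : Fin S.m) (q : S.Digit i) : ℝ :=
  P.1 i q.1 / S.p i *
    (S.a i q.1 q.2 ^ S.fibreDim P / ∑ k, S.a i q.1 k ^ S.fibreDim P)

theorem digitWeight_nonneg (P : S.weights) (i : Fin S.m) (q : S.Digit i) :
    0 ≤ S.digitWeight P i q :=
  mul_nonneg (div_nonneg (P.2.1 i q.1) (S.p_pos i).le)
    (div_nonneg (Real.rpow_nonneg (S.a_pos i q.1 q.2).le _) (S.rowSum_pos _ i q.1).le)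

theorem digitWeight_sum (P : S.weights) (i : Fin S.m) : ∑ q, S.digitWeight P i q = 1 := by
  rw [Fintype.sum_sigma]
  simp only [digitWeight]
  have h : ∀ j, ∑ k, P.1 i j / S.p i *
      (S.a i j k ^ S.fibreDim P / ∑ k, S.a i j k ^ S.fibreDim P) = P.1 i j / S.p i := by
    intro j
    rw [← Finset.mul_sum, ← Finset.sum_div, div_self (S.rowSum_pos _ i j).ne', mul_one]
  simp only [h]
  rw [← Finset.sum_div, P.2.2 i, div_self (S.p_pos i).ne']

instance isProbabilityMeasure_p : IsProbabilityMeasure (weightedMeasure S.p) :=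
  isProbabilityMeasure_weightedMeasure _ (fun i => (S.p_pos i).le) S.p_sum

instance isProbabilityMeasure_digit (P : S.weights) (i : Fin S.m) :
    IsProbabilityMeasure (weightedMeasure (S.digitWeight P i)) :=
  isProbabilityMeasure_weightedMeasure _ (S.digitWeight_nonneg P i) (S.digitWeight_sum P i)

/-- The Bernoulli measure on the digit sequences of the environment `i`. -/
noncomputable def symbolicMeasure (P : S.weights) (i : ℕ → Fin S.m) :
    Measure (∀ n, S.Digit (i n)) :=
  Measure.infinitePi (fun n => weightedMeasure (S.digitWeight P (i n)))

theorem affMap_mem_unitSquare (i : Fin S.m) (q : S.Digit i) {x : EuclideanSpace ℝ (Fin 2)}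
    (hx : x ∈ unitSquare) : S.affMap i q x ∈ unitSquare := by
  obtain ⟨j, k⟩ := q
  have hb : 0 < S.b i j := (S.a_pos i j k).trans_le (S.a_le_b i j k)
  have ha := S.a_pos i j k
  have hd : S.b i j + S.d i j ≤ 1 := by
    by_cases h : (j : ℕ) + 1 = S.rows i
    · linarith [S.d_last i j h]
    · have hlt : (j : ℕ) + 1 < S.rows i := by omega
      linarith [S.d_gap i j ⟨j + 1, hlt⟩ rfl, S.d_lt_one i ⟨j + 1, hlt⟩]
  have hc : S.a i j k + S.c i j k ≤ 1 := by
    by_cases h : (k : ℕ) + 1 = S.cols i j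
    · linarith [S.c_last i j k h]
    · have hlt : (k : ℕ) + 1 < S.cols i j := by omega
      linarith [S.c_gap i j k ⟨k + 1, hlt⟩ rfl, S.c_lt_one i j ⟨k + 1, hlt⟩]
  have hc0 := S.c_nonneg i j k
  have hd0 := S.d_nonneg i j
  obtain ⟨h00, h01⟩ := hx 0
  obtain ⟨h10, h11⟩ := hx 1
  intro l
  fin_cases l
  · constructor
    · simp only [affMap, Fin.zero_eta, PiLp.toLp_apply, Matrix.cons_val_zero]
      positivity
    · simp only [affMap, Fin.zero_eta, PiLp.toLp_apply, Matrix.cons_val_zero]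
      nlinarith
  · constructor
    · simp only [affMap, Fin.mk_one, PiLp.toLp_apply, Matrix.cons_val_one, Matrix.cons_val_fin_one]
      positivity
    · simp only [affMap, Fin.mk_one, PiLp.toLp_apply, Matrix.cons_val_one, Matrix.cons_val_fin_one]
      nlinarith

theorem continuous_affMap (i : Fin S.m) (q : S.Digit i) : Continuous (S.affMap i q) := by
  unfold affMap
  refine (PiLp.continuous_toLp 2 _).comp (continuous_pi fun l => ?_)
  fin_cases l
  · simp only [Fin.zero_eta, Matrix.cons_val_zero]
    fun_prop
  · simp only [Fin.mk_one, Matrix.cons_val_one, Matrix.cons_val_fin_one]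
    fun_prop

theorem continuous_compMap (i : ℕ → Fin S.m) (ω : ∀ n, S.Digit (i n)) (n : ℕ) :
    Continuous (S.compMap i ω n) := by
  induction n with
  | zero => exact continuous_id
  | succ n ih => exact ih.comp (S.continuous_affMap _ _)

theorem isCompact_unitSquare : IsCompact unitSquare := by
  have h : unitSquare = (WithLp.toLp 2) '' (Set.univ.pi fun _ : Fin 2 => Set.Icc (0 : ℝ) 1) := by
    ext x
    constructor
    · intro hx
      exact ⟨fun l => x l, fun l _ => hx l, rfl⟩
    · rintro ⟨y, hy, rfl⟩ l
      exact hy l trivial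
  rw [h]
  exact (isCompact_univ_pi fun _ => isCompact_Icc).image (PiLp.continuous_toLp 2 _)

/-- Along a composition both coordinates of a difference are contracted at least by the factor
`B ^ n`, where `B` bounds all the heights. -/
theorem abs_compMap_sub_le (i : ℕ → Fin S.m) (ω : ∀ n, S.Digit (i n)) {B : ℝ}
    (hB : ∀ i j, S.b i j ≤ B) (n : ℕ) (x y : EuclideanSpace ℝ (Fin 2)) (l : Fin 2) :
    |S.compMap i ω n x l - S.compMap i ω n y l| ≤ B ^ n * |x l - y l| := by
  induction n generalizing x y with
  | zero => simp [compMap]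
  | succ n ih =>
    have hstep : |S.affMap (i n) (ω n) x l - S.affMap (i n) (ω n) y l| ≤ B * |x l - y l| := by
      have ha := S.a_pos (i n) (ω n).1 (ω n).2
      have hab := S.a_le_b (i n) (ω n).1 (ω n).2
      have hbB := hB (i n) (ω n).1
      fin_cases l
      · have h : S.affMap (i n) (ω n) x 0 - S.affMap (i n) (ω n) y 0 =
            S.a (i n) (ω n).1 (ω n).2 * (x 0 - y 0) := by
          simp [affMap]; ring
        change |S.affMap (i n) (ω n) x 0 - S.affMap (i n) (ω n) y 0| ≤ B * |x 0 - y 0|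
        rw [h, abs_mul, abs_of_pos ha]
        exact mul_le_mul_of_nonneg_right (hab.trans hbB) (abs_nonneg _)
      · have h : S.affMap (i n) (ω n) x 1 - S.affMap (i n) (ω n) y 1 =
            S.b (i n) (ω n).1 * (x 1 - y 1) := by
          simp [affMap]; ring
        change |S.affMap (i n) (ω n) x 1 - S.affMap (i n) (ω n) y 1| ≤ B * |x 1 - y 1|
        rw [h, abs_mul, abs_of_pos (ha.trans_le hab)]
        exact mul_le_mul_of_nonneg_right hbB (abs_nonneg _)
    have hB0 : 0 ≤ B :=
      ((S.a_pos (i n) (ω n).1 (ω n).2).le.trans (S.a_le_b (i n) (ω n).1 (ω n).2)).trans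
        (hB (i n) (ω n).1)
    calc |S.compMap i ω (n + 1) x l - S.compMap i ω (n + 1) y l|
        ≤ B ^ n * |S.affMap (i n) (ω n) x l - S.affMap (i n) (ω n) y l| := ih _ _
      _ ≤ B ^ n * (B * |x l - y l|) := mul_le_mul_of_nonneg_left hstep (pow_nonneg hB0 n)
      _ = B ^ (n + 1) * |x l - y l| := by ring

/-- The basic rectangles of a digit sequence shrink to exactly one point. -/
theorem existsUnique_mem_rect (i : ℕ → Fin S.m) (ω : ∀ n, S.Digit (i n)) :
    ∃! x, ∀ n, x ∈ S.rect i ω n := by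
  have hcpt : ∀ n, IsCompact (S.rect i ω n) := fun n =>
    isCompact_unitSquare.image (S.continuous_compMap i ω n)
  have hne : (⋂ n, S.rect i ω n).Nonempty := by
    refine IsCompact.nonempty_iInter_of_sequence_nonempty_isCompact_isClosed _ (fun n => ?_)
      (fun n => ?_) (hcpt 0) (fun n => (hcpt n).isClosed)
    · rintro _ ⟨x, hx, rfl⟩
      exact ⟨S.affMap (i n) (ω n) x, S.affMap_mem_unitSquare _ _ hx, rfl⟩
    · exact ⟨_, ⟨0, fun l => by simp, rfl⟩⟩
  obtain ⟨x, hx⟩ := hne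
  refine ⟨x, fun n => Set.mem_iInter.1 hx n, fun y hy => ?_⟩
  have hB : ∃ B : ℝ, 0 ≤ B ∧ B < 1 ∧ ∀ i j, S.b i j ≤ B := by
    let g : ((i : Fin S.m) × Fin (S.rows i)) → ℝ := fun z => S.b z.1 z.2
    have : Nonempty ((i : Fin S.m) × Fin (S.rows i)) := ⟨⟨i 0, (ω 0).1⟩⟩
    obtain ⟨z, hz⟩ := Finite.exists_max g
    refine ⟨g z, ?_, S.b_lt_one z.1 z.2, fun i j => hz ⟨i, j⟩⟩
    exact (S.a_pos z.1 z.2 ⟨0, S.cols_pos _ _⟩).le.trans (S.a_le_b _ _ _)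
  obtain ⟨B, hB0, hB1, hB⟩ := hB
  ext l
  have hle : ∀ n : ℕ, |y l - x l| ≤ B ^ n := by
    intro n
    obtain ⟨u, hu, rfl⟩ := hy n
    obtain ⟨v, hv, hvx⟩ := Set.mem_iInter.1 hx n
    rw [← hvx]
    refine (S.abs_compMap_sub_le i ω hB n u v l).trans
      (mul_le_of_le_one_right (pow_nonneg hB0 n) ?_)
    rw [abs_le]
    obtain ⟨h1, h2⟩ := hu l
    obtain ⟨h3, h4⟩ := hv l
    constructor <;> linarith
  have h0 : |y l - x l| ≤ 0 :=
    ge_of_tendsto' (tendsto_pow_atTop_nhds_zero_of_lt_one hB0 hB1) hle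
  exact sub_eq_zero.1 (abs_nonpos_iff.1 h0)

/-- The coding map: the only common point of the basic rectangles of a digit sequence. -/
noncomputable def coding (i : ℕ → Fin S.m) (ω : ∀ n, S.Digit (i n)) :
    EuclideanSpace ℝ (Fin 2) :=
  (S.existsUnique_mem_rect i ω).choose

/-- The Bernoulli measure of `P` on the random set of the environment `i`. -/
noncomputable def bernoulli (P : S.weights) (i : ℕ → Fin S.m) :
    Measure (EuclideanSpace ℝ (Fin 2)) :=
  (S.symbolicMeasure P i).map (S.coding i)

end RandomCarpet

/-! Let δ be the maximum of λ + t, which exists by compactness (`exists_isMax_dim`). The equalities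
hold in every environment whose letters have the frequencies `p`, an almost sure property
(`ae_typical`). Both bounds measure approximate squares: the sequences sharing the first n digits
and the first L ≥ n rows, with n and L the orders at which width and height fall to about r. If rows
have probabilities q and columns within a row are weighted by a ^ t, the logarithm of the measure of
such a square is the sum of log q over L steps, plus t * log(width), minus the sum of `logRowSum t`
over n steps (`digitMeasure_box_eq_exp`).

Lower bound (`le_measureDimH_bernoulli`). For t = t(P) the last sum has mean zero, and the first is
on average λ(P) times the logarithm of the height. By the law of large numbers most squares have
measure at most r ^ (λ(P) + t(P) - o(1)). A set of diameter r meets boundedly many squares of size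
r, so the mass distribution principle applies.

Upper bound (`dimH_limitSet_le`). Each sequence has a critical exponent t on a fine finite grid: its
sums of `logRowSum t` are infinitely often nonnegative and eventually at most κ * n. For a given t,
take row probabilities proportional to b ^ (δ - t) * exp(ρ * logRowSum t) with ρ ≥ 0. At infinitely
many orders the ρ-term only helps, and the remaining sum costs at most κ * n. If the pressure, the
mean logarithm of the normalising constants, is at most κ, these squares have measure at least r ^
(δ + O(κ)) up to a constant, so they form efficient covers.

Such a ρ exists by Lagrange duality (`exists_sum_log_partitionSum_le`): nonnegativity of the mean of
`logRowSum t` under P forces t ≤ t(P), hence λ(P) ≤ δ - t, and ρ is the multiplier of this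
constraint. -/

open scoped Topology

/-! ### Finite weighted measures and a law of large numbers -/

section WeightedMeasure

variable {α : Type} [Fintype α] [MeasurableSpace α] [DiscreteMeasurableSpace α]

theorem weightedMeasure_apply (w : α → ℝ) (h0 : ∀ x, 0 ≤ w x) (s : Set α) [DecidablePred (· ∈ s)] :
    weightedMeasure w s = ENNReal.ofReal (∑ x with x ∈ s, w x) := by
  rw [weightedMeasure, Measure.coe_finsetSum, Finset.sum_apply, Finset.sum_filter,
    ENNReal.ofReal_sum_of_nonneg fun x _ => by split_ifs <;> simp [h0]]
  refine Finset.sum_congr rfl fun x _ => ?_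
  by_cases h : x ∈ s <;> simp [h]

theorem integral_weightedMeasure (w : α → ℝ) (h0 : ∀ x, 0 ≤ w x) (g : α → ℝ) :
    ∫ x, g x ∂weightedMeasure w = ∑ x, w x * g x := by
  rw [weightedMeasure, integral_finsetSum_measure]
  · refine Finset.sum_congr rfl fun x _ => ?_
    rw [integral_smul_measure, integral_dirac, ENNReal.toReal_ofReal (h0 x), smul_eq_mul]
  · intro x _
    exact (integrable_dirac (by simp)).smul_measure ENNReal.ofReal_ne_top

end WeightedMeasure

/-- A one-sided law of large numbers for bounded centered functions of independent, not
necessarily identically distributed, random letters. -/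
theorem ae_eventually_sum_le {α : ℕ → Type} [∀ n, Fintype (α n)] [∀ n, MeasurableSpace (α n)]
    [∀ n, DiscreteMeasurableSpace (α n)] (w : ∀ n, α n → ℝ) (h0 : ∀ n x, 0 ≤ w n x)
    [∀ n, IsProbabilityMeasure (weightedMeasure (w n))] (g : ∀ n, α n → ℝ) {K : ℝ}
    (hK : ∀ n x, |g n x| ≤ K) (hg : ∀ n, ∑ x, w n x * g n x = 0) {κ : ℝ} (hκ : 0 < κ) :
    ∀ᵐ ω ∂Measure.infinitePi (fun n => weightedMeasure (w n)),
      ∀ᶠ n : ℕ in Filter.atTop, ∑ l ∈ Finset.range n, g l (ω l) ≤ κ * n := by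
  set μ := Measure.infinitePi (fun n => weightedMeasure (w n))
  have hmeas : ∀ n, Measurable (g n) := fun n => .of_discrete
  have hind : ProbabilityTheory.iIndepFun (fun n (ω : ∀ n, α n) => g n (ω n)) μ :=
    ProbabilityTheory.iIndepFun_infinitePi hmeas
  -- The interval [-(K + 1), K + 1], wider than [-K, K], keeps the variance proxy positive even when
  -- K = 0.
  set c : NNReal := (‖K + 1 - -(K + 1)‖₊ / 2) ^ 2 with hc
  have hK0 : 0 ≤ K := by
    obtain ⟨x⟩ := (weightedMeasure (w 0)).nonempty_of_neZero
    exact (abs_nonneg _).trans (hK 0 x)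
  have hcpos : 0 < (c : ℝ) := by
    have h : (K + 1 - -(K + 1)) ≠ 0 := by linarith
    have := nnnorm_pos.2 h
    rw [hc]
    positivity
  have hsub : ∀ n, ProbabilityTheory.HasSubgaussianMGF (fun ω : ∀ n, α n => g n (ω n)) c μ := by
    intro n
    refine ProbabilityTheory.hasSubgaussianMGF_of_mem_Icc_of_integral_eq_zero
      ((hmeas n).comp (measurable_pi_apply n)).aemeasurable
      (Filter.Eventually.of_forall fun ω => ?_) ?_
    · have := abs_le.1 (hK n (ω n))
      constructor <;> linarith
    · have h := Measure.infinitePi_map_eval (fun n => weightedMeasure (w n)) n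
      rw [← hg n, ← integral_weightedMeasure (w n) (h0 n), ← h, integral_map
        (measurable_pi_apply n).aemeasurable (hmeas n).aestronglyMeasurable]
  -- Hoeffding's inequality: deviations of size κ * n have geometrically small probability, so
  -- Borel–Cantelli applies.
  have hbound : ∀ n : ℕ, μ {ω | κ * n ≤ ∑ l ∈ Finset.range n, g l (ω l)} ≤
      ENNReal.ofReal (Real.exp (-(κ ^ 2 / (2 * c))) ^ n) := by
    intro n
    rw [← ofReal_measureReal]
    refine ENNReal.ofReal_le_ofReal ?_
    refine (ProbabilityTheory.HasSubgaussianMGF.measure_sum_range_ge_le_of_iIndepFun hind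
      (fun i _ => hsub i) (ε := κ * n) (by positivity)).trans_eq ?_
    rw [← Real.exp_nat_mul]
    congr 1
    rcases Nat.eq_zero_or_pos n with rfl | hn
    · simp
    · have : (n : ℝ) ≠ 0 := by positivity
      field_simp
  have hlt : Real.exp (-(κ ^ 2 / (2 * c))) < 1 := Real.exp_lt_one_iff.2 (by
    have : 0 < κ ^ 2 / (2 * c) := by positivity
    linarith)
  have hsum : ∑' n, μ {ω | κ * n ≤ ∑ l ∈ Finset.range n, g l (ω l)} ≠ ⊤ := by
    refine ne_top_of_le_ne_top ?_ (ENNReal.tsum_le_tsum hbound)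
    exact ((summable_geometric_of_lt_one (Real.exp_pos _).le hlt)).tsum_ofReal_ne_top
  filter_upwards [ae_eventually_notMem hsum] with ω hω
  filter_upwards [hω] with n hn
  exact (not_le.1 hn).le

/-! ### Typical environments and Bernoulli measures -/

namespace RandomCarpet

variable (S : RandomCarpet)

/-- An environment is typical if the averages of functions of the families along it do not exceed
their expectations asymptotically. -/
def Typical (i : ℕ → Fin S.m) : Prop :=
  ∀ (h : Fin S.m → ℝ) (κ : ℝ), 0 < κ → ∀ᶠ n : ℕ in Filter.atTop,
    ∑ l ∈ Finset.range n, h (i l) ≤ (∑ x, S.p x * h x + κ) * n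

/-- The exceptional null set must not depend on the function. It suffices to control the frequency
of each letter, from both sides and for countably many tolerances, since every function of the
family is a linear combination of indicators of letters. -/
theorem ae_typical : ∀ᵐ i ∂S.envMeasure, S.Typical i := by
  have hone : ∀ (σ : ℝ) (x : Fin S.m) (r : ℕ), ∀ᵐ i ∂S.envMeasure, ∀ᶠ n : ℕ in Filter.atTop,
      ∑ l ∈ Finset.range n, σ * ((if i l = x then 1 else 0) - S.p x) ≤ 1 / ((r : ℝ) + 1) * n := by
    intro σ x r
    refine ae_eventually_sum_le (fun _ => S.p) (fun _ i => (S.p_pos i).le)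
      (fun _ y => σ * ((if y = x then 1 else 0) - S.p x)) (K := |σ| * (1 + S.p x))
      (fun _ y => ?_) (fun _ => ?_) (by positivity)
    · rw [abs_mul]
      refine mul_le_mul_of_nonneg_left ?_ (abs_nonneg _)
      have := S.p_pos x
      rw [abs_le]
      split_ifs <;> constructor <;> linarith
    · have h : ∀ y, S.p y * (σ * ((if y = x then 1 else 0) - S.p x)) =
          σ * ((if y = x then S.p y else 0) - S.p y * S.p x) := by
        intro y; split_ifs <;> ring
      simp only [h, ← Finset.mul_sum, Finset.sum_sub_distrib, ← Finset.sum_mul, S.p_sum]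
      simp
  have hall : ∀ᵐ i ∂S.envMeasure, ∀ (x : Fin S.m) (r : ℕ),
      (∀ᶠ n : ℕ in Filter.atTop, ∑ l ∈ Finset.range n,
        (1 : ℝ) * ((if i l = x then 1 else 0) - S.p x) ≤ 1 / ((r : ℝ) + 1) * n) ∧
      ∀ᶠ n : ℕ in Filter.atTop, ∑ l ∈ Finset.range n,
        (-1 : ℝ) * ((if i l = x then 1 else 0) - S.p x) ≤ 1 / ((r : ℝ) + 1) * n := by
    rw [ae_all_iff]; intro x
    rw [ae_all_iff]; intro r
    filter_upwards [hone 1 x r, hone (-1) x r] with i h1 h2 using ⟨h1, h2⟩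
  filter_upwards [hall] with i hi
  intro h κ hκ
  obtain ⟨r, hr⟩ := exists_nat_one_div_lt (show 0 < κ / (∑ x, |h x| + 1) by positivity)
  have hev : ∀ᶠ n : ℕ in Filter.atTop, ∀ x : Fin S.m,
      |∑ l ∈ Finset.range n, ((if i l = x then (1 : ℝ) else 0) - S.p x)| ≤
        1 / ((r : ℝ) + 1) * n := by
    rw [Filter.eventually_all]
    intro x
    filter_upwards [(hi x r).1, (hi x r).2] with n h1 h2
    rw [← Finset.mul_sum] at h1 h2
    rw [abs_le]
    constructor <;> linarith
  filter_upwards [hev] with n hn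
  have hdecomp : ∑ l ∈ Finset.range n, h (i l) = (∑ x, S.p x * h x) * n +
      ∑ x, h x * ∑ l ∈ Finset.range n, ((if i l = x then (1 : ℝ) else 0) - S.p x) := by
    have h1 : ∀ l, h (i l) = ∑ x, h x * (if i l = x then (1 : ℝ) else 0) := by
      intro l; simp
    simp only [Finset.sum_sub_distrib, mul_sub, Finset.sum_const, Finset.card_range,
      nsmul_eq_mul, Finset.mul_sum]
    rw [Finset.sum_comm, ← Finset.sum_congr rfl fun l _ => h1 l, Finset.sum_mul,
      Finset.sum_congr rfl fun x _ => show h x * (n * S.p x) = S.p x * h x * n by ring]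
    ring
  rw [hdecomp, add_mul]
  refine add_le_add_right ?_ _
  calc ∑ x, h x * ∑ l ∈ Finset.range n, ((if i l = x then (1 : ℝ) else 0) - S.p x)
      ≤ ∑ x, |h x| * (1 / ((r : ℝ) + 1) * n) := Finset.sum_le_sum fun x _ =>
        (le_abs_self _).trans (by
          rw [abs_mul]; exact mul_le_mul_of_nonneg_left (hn x) (abs_nonneg _))
    _ = (∑ x, |h x|) * (1 / ((r : ℝ) + 1)) * n := by rw [← Finset.sum_mul]; ring
    _ ≤ κ * n := by
        refine mul_le_mul_of_nonneg_right ?_ (Nat.cast_nonneg _)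
        rw [lt_div_iff₀ (by positivity)] at hr
        have : 0 < 1 / ((r : ℝ) + 1) := by positivity
        nlinarith

/-- Row probabilities of a Bernoulli measure, family by family. -/
structure IsRowWeight (q : (i : Fin S.m) → Fin (S.rows i) → ℝ) : Prop where
  nonneg : ∀ i j, 0 ≤ q i j
  sum_eq : ∀ i, ∑ j, q i j = 1

/-- The digit probabilities with row probabilities `q` and with probabilities proportional to the
`t`-th powers of the widths within a row. -/
noncomputable def bernoulliWeight (q : (i : Fin S.m) → Fin (S.rows i) → ℝ) (t : ℝ) (i : Fin S.m)
    (x : S.Digit i) : ℝ :=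
  q i x.1 * (S.a i x.1 x.2 ^ t / ∑ k, S.a i x.1 k ^ t)

variable {S} {q : (i : Fin S.m) → Fin (S.rows i) → ℝ}

theorem bernoulliWeight_nonneg (hq : S.IsRowWeight q) (t : ℝ) (i : Fin S.m) (x : S.Digit i) :
    0 ≤ S.bernoulliWeight q t i x :=
  mul_nonneg (hq.nonneg _ _)
    (div_nonneg (Real.rpow_nonneg (S.a_pos i x.1 x.2).le _) (S.rowSum_pos _ i x.1).le)

theorem sum_bernoulliWeight_row (q : (i : Fin S.m) → Fin (S.rows i) → ℝ) (t : ℝ) (i : Fin S.m)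
    (j : Fin (S.rows i)) : ∑ k, S.bernoulliWeight q t i ⟨j, k⟩ = q i j := by
  change ∑ k, q i j * (S.a i j k ^ t / ∑ k', S.a i j k' ^ t) = q i j
  rw [← Finset.mul_sum, ← Finset.sum_div, div_self (S.rowSum_pos _ i j).ne', mul_one]

theorem sum_bernoulliWeight_mul (q : (i : Fin S.m) → Fin (S.rows i) → ℝ) (t : ℝ) (i : Fin S.m)
    (g : Fin (S.rows i) → ℝ) :
    ∑ x, S.bernoulliWeight q t i x * g x.1 = ∑ j, q i j * g j := by
  rw [Fintype.sum_sigma]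
  simp only [← Finset.sum_mul, sum_bernoulliWeight_row]

theorem sum_bernoulliWeight (hq : S.IsRowWeight q) (t : ℝ) (i : Fin S.m) :
    ∑ x, S.bernoulliWeight q t i x = 1 := by
  simpa [hq.sum_eq] using S.sum_bernoulliWeight_mul q t i (fun _ => 1)

theorem isProbabilityMeasure_bernoulliWeight (hq : S.IsRowWeight q) (t : ℝ) (i : Fin S.m) :
    IsProbabilityMeasure (weightedMeasure (S.bernoulliWeight q t i)) :=
  isProbabilityMeasure_weightedMeasure _ (bernoulliWeight_nonneg hq t i) (sum_bernoulliWeight hq t i)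

variable (S) in
/-- The Bernoulli measure on the digit sequences of the environment `i` with row probabilities `q`
and with conditional probabilities proportional to the `t`-th powers of the widths. -/
noncomputable def digitMeasure (q : (i : Fin S.m) → Fin (S.rows i) → ℝ) (t : ℝ)
    (i : ℕ → Fin S.m) : Measure (∀ n, S.Digit (i n)) :=
  Measure.infinitePi (fun n => weightedMeasure (S.bernoulliWeight q t (i n)))

theorem isProbabilityMeasure_digitMeasure (hq : S.IsRowWeight q) (t : ℝ) (i : ℕ → Fin S.m) :
    IsProbabilityMeasure (S.digitMeasure q t i) := by
  have := isProbabilityMeasure_bernoulliWeight hq t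
  unfold digitMeasure
  infer_instance

/-- Only the digits are random here, and they are not identically distributed. Subtracting from `g`
its conditional mean `M` given the family leaves independent centered terms; the sum of `M` depends
on the environment alone and is controlled by typicality. Each part receives half of κ. -/
theorem ae_eventually_rowSum_le (hq : S.IsRowWeight q) (t : ℝ) {i : ℕ → Fin S.m}
    (hi : S.Typical i) (g : (i : Fin S.m) → Fin (S.rows i) → ℝ)
    (hg : ∑ i, S.p i * ∑ j, q i j * g i j ≤ 0) {κ : ℝ} (hκ : 0 < κ) :
    ∀ᵐ ω ∂S.digitMeasure q t i, ∀ᶠ n : ℕ in Filter.atTop,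
      ∑ l ∈ Finset.range n, g (i l) (ω l).1 ≤ κ * n := by
  have := isProbabilityMeasure_bernoulliWeight hq t
  set M : Fin S.m → ℝ := fun i => ∑ j, q i j * g i j
  let K : ℝ := ∑ i, (|M i| + ∑ j, |g i j|)
  have hK : ∀ i j, |g i j - M i| ≤ K := by
    intro i j
    refine (abs_sub _ _).trans ?_
    have h1 : |g i j| ≤ ∑ j, |g i j| :=
      Finset.single_le_sum (f := fun j => |g i j|) (fun _ _ => abs_nonneg _) (Finset.mem_univ j)
    have h2 : |M i| + ∑ j, |g i j| ≤ K :=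
      Finset.single_le_sum (f := fun i => |M i| + ∑ j, |g i j|) (fun _ _ => by positivity)
        (Finset.mem_univ i)
    linarith
  have hmain := ae_eventually_sum_le (fun n => S.bernoulliWeight q t (i n))
    (fun n => bernoulliWeight_nonneg hq t (i n)) (fun n x => g (i n) x.1 - M (i n))
    (fun n x => hK (i n) x.1) (fun n => ?_) (half_pos hκ)
  · filter_upwards [hmain] with ω hω
    filter_upwards [hω, hi M (κ / 2) (half_pos hκ)] with n h1 h2
    rw [Finset.sum_sub_distrib] at h1
    have h3 : (∑ x, S.p x * M x) * n ≤ 0 := mul_nonpos_of_nonpos_of_nonneg hg (Nat.cast_nonneg _)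
    linarith
  · have h := S.sum_bernoulliWeight_mul q t (i n) (fun j => g (i n) j - M (i n))
    rw [h]
    simp only [mul_sub, Finset.sum_sub_distrib, ← Finset.sum_mul, hq.sum_eq, one_mul]
    exact sub_self _

end RandomCarpet

/-! ### Geometry of the basic rectangles -/

namespace RandomCarpet

variable (S : RandomCarpet)

/-- The width of the basic rectangle of order `n` of the digit sequence `ω`. -/
noncomputable def width (i : ℕ → Fin S.m) (ω : ∀ n, S.Digit (i n)) (n : ℕ) : ℝ :=
  ∏ l ∈ Finset.range n, S.a (i l) (ω l).1 (ω l).2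

/-- The height of the basic rectangle of order `n` of the digit sequence `ω`. -/
noncomputable def height (i : ℕ → Fin S.m) (ω : ∀ n, S.Digit (i n)) (n : ℕ) : ℝ :=
  ∏ l ∈ Finset.range n, S.b (i l) (ω l).1

/-- The left end of the basic rectangle of order `n` of the digit sequence `ω`. -/
noncomputable def left (i : ℕ → Fin S.m) (ω : ∀ n, S.Digit (i n)) (n : ℕ) : ℝ :=
  ∑ l ∈ Finset.range n, S.width i ω l * S.c (i l) (ω l).1 (ω l).2

/-- The lower end of the basic rectangle of order `n` of the digit sequence `ω`. -/
noncomputable def bottom (i : ℕ → Fin S.m) (ω : ∀ n, S.Digit (i n)) (n : ℕ) : ℝ :=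
  ∑ l ∈ Finset.range n, S.height i ω l * S.d (i l) (ω l).1

variable {S} {i : ℕ → Fin S.m}

theorem b_pos (i : Fin S.m) (j : Fin (S.rows i)) : 0 < S.b i j :=
  (S.a_pos i j ⟨0, S.cols_pos i j⟩).trans_le (S.a_le_b i j _)

theorem d_add_b_le_one (i : Fin S.m) (j : Fin (S.rows i)) : S.d i j + S.b i j ≤ 1 := by
  by_cases h : (j : ℕ) + 1 = S.rows i
  · linarith [S.d_last i j h]
  · have hlt : (j : ℕ) + 1 < S.rows i := by omega
    linarith [S.d_gap i j ⟨j + 1, hlt⟩ rfl, S.d_lt_one i ⟨j + 1, hlt⟩]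

theorem c_add_a_le_one (i : Fin S.m) (j : Fin (S.rows i)) (k : Fin (S.cols i j)) :
    S.c i j k + S.a i j k ≤ 1 := by
  by_cases h : (k : ℕ) + 1 = S.cols i j
  · linarith [S.c_last i j k h]
  · have hlt : (k : ℕ) + 1 < S.cols i j := by omega
    linarith [S.c_gap i j k ⟨k + 1, hlt⟩ rfl, S.c_lt_one i j ⟨k + 1, hlt⟩]

theorem d_add_b_le (i : Fin S.m) {j j' : Fin (S.rows i)} (h : j < j') :
    S.d i j + S.b i j ≤ S.d i j' := by
  have hlt : (j : ℕ) + 1 < S.rows i := by have := j'.2; have : (j : ℕ) < j' := h; omega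
  have h1 := S.d_gap i j ⟨j + 1, hlt⟩ rfl
  have h2 : S.d i ⟨j + 1, hlt⟩ ≤ S.d i j' := (S.d_strictMono i).monotone h
  linarith

theorem c_add_a_le (i : Fin S.m) (j : Fin (S.rows i)) {k k' : Fin (S.cols i j)} (h : k < k') :
    S.c i j k + S.a i j k ≤ S.c i j k' := by
  have hlt : (k : ℕ) + 1 < S.cols i j := by have := k'.2; have : (k : ℕ) < k' := h; omega
  have h1 := S.c_gap i j k ⟨k + 1, hlt⟩ rfl
  have h2 : S.c i j ⟨k + 1, hlt⟩ ≤ S.c i j k' := (S.c_strictMono i j).monotone h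
  linarith

theorem m_pos (S : RandomCarpet) : 0 < S.m := by
  rcases Nat.eq_zero_or_pos S.m with h | h
  · have : IsEmpty (Fin S.m) := by rw [h]; infer_instance
    simpa using S.p_sum
  · exact h

theorem exists_bounds (S : RandomCarpet) : ∃ α β : ℝ, 0 < α ∧ α < 1 ∧ 0 < β ∧ β < 1 ∧
    (∀ i j k, α ≤ S.a i j k) ∧ ∀ i j, S.b i j ≤ β := by
  let i₀ : Fin S.m := ⟨0, S.m_pos⟩
  let j₀ : Fin (S.rows i₀) := ⟨0, S.rows_pos i₀⟩
  have : Nonempty ((i : Fin S.m) × S.Digit i) := ⟨⟨i₀, j₀, ⟨0, S.cols_pos i₀ j₀⟩⟩⟩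
  have : Nonempty ((i : Fin S.m) × Fin (S.rows i)) := ⟨⟨i₀, j₀⟩⟩
  obtain ⟨x, hx⟩ := Finite.exists_min fun x : (i : Fin S.m) × S.Digit i => S.a x.1 x.2.1 x.2.2
  obtain ⟨y, hy⟩ := Finite.exists_max fun y : (i : Fin S.m) × Fin (S.rows i) => S.b y.1 y.2
  exact ⟨_, _, S.a_pos _ _ _, (S.a_le_b _ _ _).trans_lt (S.b_lt_one x.1 x.2.1), b_pos y.1 y.2,
    S.b_lt_one _ _, fun i j k => hx ⟨i, j, k⟩, fun i j => hy ⟨i, j⟩⟩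

section Rectangles

variable (ω ω' : ∀ n, S.Digit (i n))

@[simp] theorem width_zero : S.width i ω 0 = 1 := by simp [width]

@[simp] theorem height_zero : S.height i ω 0 = 1 := by simp [height]

@[simp] theorem left_zero : S.left i ω 0 = 0 := by simp [left]

@[simp] theorem bottom_zero : S.bottom i ω 0 = 0 := by simp [bottom]

theorem width_succ (n : ℕ) :
    S.width i ω (n + 1) = S.width i ω n * S.a (i n) (ω n).1 (ω n).2 :=
  Finset.prod_range_succ _ _

theorem height_succ (n : ℕ) :
    S.height i ω (n + 1) = S.height i ω n * S.b (i n) (ω n).1 :=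
  Finset.prod_range_succ _ _

theorem left_succ (n : ℕ) :
    S.left i ω (n + 1) = S.left i ω n + S.width i ω n * S.c (i n) (ω n).1 (ω n).2 :=
  Finset.sum_range_succ _ _

theorem bottom_succ (n : ℕ) :
    S.bottom i ω (n + 1) = S.bottom i ω n + S.height i ω n * S.d (i n) (ω n).1 :=
  Finset.sum_range_succ _ _

theorem width_pos (n : ℕ) : 0 < S.width i ω n :=
  Finset.prod_pos fun _ _ => S.a_pos _ _ _

theorem height_pos (n : ℕ) : 0 < S.height i ω n :=
  Finset.prod_pos fun _ _ => b_pos _ _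

theorem width_le_height (n : ℕ) : S.width i ω n ≤ S.height i ω n :=
  Finset.prod_le_prod (fun _ _ => (S.a_pos _ _ _).le) fun _ _ => S.a_le_b _ _ _

theorem pow_le_width {α : ℝ} (hα : 0 < α) (h : ∀ i j k, α ≤ S.a i j k) (n : ℕ) :
    α ^ n ≤ S.width i ω n := by
  have := Finset.prod_le_prod (s := Finset.range n) (fun _ _ => hα.le)
    (fun l _ => h (i l) (ω l).1 (ω l).2)
  simpa [width] using this

theorem height_le_pow {β : ℝ} (h : ∀ i j, S.b i j ≤ β) (n : ℕ) : S.height i ω n ≤ β ^ n := by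
  have := Finset.prod_le_prod (s := Finset.range n) (fun l _ => (b_pos (i l) (ω l).1).le)
    (fun l _ => h (i l) (ω l).1)
  simpa [height] using this

theorem log_width (n : ℕ) : Real.log (S.width i ω n) =
    ∑ l ∈ Finset.range n, Real.log (S.a (i l) (ω l).1 (ω l).2) :=
  Real.log_prod fun _ _ => (S.a_pos _ _ _).ne'

theorem log_height (n : ℕ) : Real.log (S.height i ω n) =
    ∑ l ∈ Finset.range n, Real.log (S.b (i l) (ω l).1) :=
  Real.log_prod fun _ _ => (b_pos _ _).ne'

theorem monotone_left : Monotone (S.left i ω) :=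
  monotone_nat_of_le_succ fun n => by
    rw [left_succ]
    exact le_add_of_nonneg_right (mul_nonneg (width_pos ω n).le (S.c_nonneg _ _ _))

theorem monotone_bottom : Monotone (S.bottom i ω) :=
  monotone_nat_of_le_succ fun n => by
    rw [bottom_succ]
    exact le_add_of_nonneg_right (mul_nonneg (height_pos ω n).le (S.d_nonneg _ _))

theorem antitone_left_add_width : Antitone fun n => S.left i ω n + S.width i ω n :=
  antitone_nat_of_succ_le fun n => by
    rw [left_succ, width_succ]
    have h := c_add_a_le_one (i n) (ω n).1 (ω n).2
    have hw := width_pos ω n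
    nlinarith

theorem antitone_bottom_add_height : Antitone fun n => S.bottom i ω n + S.height i ω n :=
  antitone_nat_of_succ_le fun n => by
    rw [bottom_succ, height_succ]
    have h := d_add_b_le_one (i n) (ω n).1
    have hw := height_pos ω n
    nlinarith

theorem compMap_apply_zero (n : ℕ) (x : EuclideanSpace ℝ (Fin 2)) :
    S.compMap i ω n x 0 = S.width i ω n * x 0 + S.left i ω n := by
  induction n generalizing x with
  | zero => simp [compMap]
  | succ n ih =>
    rw [compMap, Function.comp_apply, ih, left_succ, width_succ]
    simp only [affMap, PiLp.toLp_apply, Matrix.cons_val_zero]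
    ring

theorem compMap_apply_one (n : ℕ) (x : EuclideanSpace ℝ (Fin 2)) :
    S.compMap i ω n x 1 = S.height i ω n * x 1 + S.bottom i ω n := by
  induction n generalizing x with
  | zero => simp [compMap]
  | succ n ih =>
    rw [compMap, Function.comp_apply, ih, bottom_succ, height_succ]
    simp only [affMap, PiLp.toLp_apply, Matrix.cons_val_one, Matrix.cons_val_fin_one]
    ring

theorem mem_rect_iff (n : ℕ) (x : EuclideanSpace ℝ (Fin 2)) : x ∈ S.rect i ω n ↔
    (S.left i ω n ≤ x 0 ∧ x 0 ≤ S.left i ω n + S.width i ω n) ∧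
      (S.bottom i ω n ≤ x 1 ∧ x 1 ≤ S.bottom i ω n + S.height i ω n) := by
  have hw := width_pos ω n
  have hh := height_pos ω n
  constructor
  · rintro ⟨y, hy, rfl⟩
    rw [compMap_apply_zero, compMap_apply_one]
    obtain ⟨h1, h2⟩ := hy 0
    obtain ⟨h3, h4⟩ := hy 1
    refine ⟨⟨?_, ?_⟩, ?_, ?_⟩ <;> nlinarith
  · rintro ⟨⟨h1, h2⟩, h3, h4⟩
    refine ⟨!₂[(x 0 - S.left i ω n) / S.width i ω n, (x 1 - S.bottom i ω n) / S.height i ω n],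
      ?_, ?_⟩
    · intro l
      fin_cases l
      · change _ / _ ∈ _
        constructor
        · exact div_nonneg (by linarith) hw.le
        · rw [div_le_one hw]; linarith
      · change _ / _ ∈ _
        constructor
        · exact div_nonneg (by linarith) hh.le
        · rw [div_le_one hh]; linarith
    · ext l
      fin_cases l
      · change S.compMap i ω n _ 0 = x 0
        rw [compMap_apply_zero]
        simp only [Matrix.cons_val_zero]
        field_simp
        ring
      · change S.compMap i ω n _ 1 = x 1
        rw [compMap_apply_one]
        simp only [Matrix.cons_val_one, Matrix.cons_val_fin_one]
        field_simp
        ring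

theorem antitone_rect : Antitone (S.rect i ω) := by
  intro n n' h x hx
  rw [mem_rect_iff] at hx ⊢
  exact ⟨⟨(monotone_left ω h).trans hx.1.1, hx.1.2.trans (antitone_left_add_width ω h)⟩,
    (monotone_bottom ω h).trans hx.2.1, hx.2.2.trans (antitone_bottom_add_height ω h)⟩

theorem coding_mem_rect (n : ℕ) : S.coding i ω ∈ S.rect i ω n :=
  (S.existsUnique_mem_rect i ω).choose_spec.1 n

theorem eq_coding {x : EuclideanSpace ℝ (Fin 2)} (hx : ∀ n, x ∈ S.rect i ω n) :
    x = S.coding i ω :=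
  (S.existsUnique_mem_rect i ω).unique hx (coding_mem_rect ω)

end Rectangles

section Congruence

variable {ω ω' : ∀ n, S.Digit (i n)} {n : ℕ}

theorem width_congr (h : ∀ l < n, ω l = ω' l) : S.width i ω n = S.width i ω' n :=
  Finset.prod_congr rfl fun l hl => by rw [h l (Finset.mem_range.1 hl)]

theorem height_congr (h : ∀ l < n, (ω l).1 = (ω' l).1) : S.height i ω n = S.height i ω' n :=
  Finset.prod_congr rfl fun l hl => by rw [h l (Finset.mem_range.1 hl)]

theorem left_congr (h : ∀ l < n, ω l = ω' l) : S.left i ω n = S.left i ω' n :=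
  Finset.sum_congr rfl fun l hl => by
    have hl := Finset.mem_range.1 hl
    rw [h l hl, width_congr fun l' hl' => h l' (hl'.trans hl)]

theorem bottom_congr (h : ∀ l < n, (ω l).1 = (ω' l).1) : S.bottom i ω n = S.bottom i ω' n :=
  Finset.sum_congr rfl fun l hl => by
    have hl := Finset.mem_range.1 hl
    rw [h l hl, height_congr fun l' hl' => h l' (hl'.trans hl)]

/-- The gaps between the `d` separate the two strips at the first differing row, and later digits
only shrink each strip within itself. -/
theorem bottom_add_height_le (h : ∀ l < n, (ω l).1 = (ω' l).1) (hn : (ω n).1 < (ω' n).1)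
    {L L' : ℕ} (hL : n < L) (hL' : n < L') :
    S.bottom i ω L + S.height i ω L ≤ S.bottom i ω' L' := by
  refine (antitone_bottom_add_height ω hL).trans (le_trans ?_ (monotone_bottom ω' hL'))
  simp only [Nat.succ_eq_add_one]
  rw [bottom_succ, bottom_succ, height_succ, bottom_congr h, height_congr h]
  have h1 := d_add_b_le (i n) hn
  have h2 := height_pos ω' n
  nlinarith

/-- The horizontal counterpart. The rows at order `n` must agree because columns of different rows
may overlap in projection. -/
theorem left_add_width_le (h : ∀ l < n, ω l = ω' l) (hn : (ω n).1 = (ω' n).1)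
    (hn' : ((ω n).2 : ℕ) < (ω' n).2) {L L' : ℕ} (hL : n < L) (hL' : n < L') :
    S.left i ω L + S.width i ω L ≤ S.left i ω' L' := by
  refine (antitone_left_add_width ω hL).trans (le_trans ?_ (monotone_left ω' hL'))
  simp only [Nat.succ_eq_add_one]
  rw [left_succ, left_succ, width_succ, left_congr h, width_congr h]
  have h2 := width_pos ω' n
  generalize ω n = x at hn hn' ⊢
  generalize ω' n = y at hn hn' ⊢
  obtain ⟨j, k⟩ := x
  obtain ⟨j', k'⟩ := y
  dsimp only at hn
  subst hn
  have h1 := c_add_a_le (i n) j (k := k) (k' := k') hn'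
  dsimp only
  nlinarith

end Congruence

/-! ### The limit set and the coding map -/

section Topology

theorem continuous_width (n : ℕ) : Continuous fun ω => S.width i ω n :=
  continuous_finsetProd _ fun l _ =>
    (continuous_of_discreteTopology (f := fun x : S.Digit (i l) => S.a (i l) x.1 x.2)).comp
      (continuous_apply l)

theorem continuous_height (n : ℕ) : Continuous fun ω => S.height i ω n :=
  continuous_finsetProd _ fun l _ =>
    (continuous_of_discreteTopology (f := fun x : S.Digit (i l) => S.b (i l) x.1)).comp
      (continuous_apply l)

theorem continuous_left (n : ℕ) : Continuous fun ω => S.left i ω n :=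
  continuous_finsetSum _ fun l _ => (continuous_width l).mul <|
    (continuous_of_discreteTopology (f := fun x : S.Digit (i l) => S.c (i l) x.1 x.2)).comp
      (continuous_apply l)

theorem continuous_bottom (n : ℕ) : Continuous fun ω => S.bottom i ω n :=
  continuous_finsetSum _ fun l _ => (continuous_height l).mul <|
    (continuous_of_discreteTopology (f := fun x : S.Digit (i l) => S.d (i l) x.1)).comp
      (continuous_apply l)

theorem isClosed_setOf_mem_rect (n : ℕ) :
    IsClosed {z : (∀ n, S.Digit (i n)) × EuclideanSpace ℝ (Fin 2) | z.2 ∈ S.rect i z.1 n} := by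
  simp only [mem_rect_iff]
  have h0 := (continuous_left (S := S) (i := i) n).comp (continuous_fst (Y := EuclideanSpace ℝ (Fin 2)))
  have h1 := (continuous_bottom (S := S) (i := i) n).comp (continuous_fst (Y := EuclideanSpace ℝ (Fin 2)))
  have h2 := (continuous_width (S := S) (i := i) n).comp (continuous_fst (Y := EuclideanSpace ℝ (Fin 2)))
  have h3 := (continuous_height (S := S) (i := i) n).comp (continuous_fst (Y := EuclideanSpace ℝ (Fin 2)))
  have h4 : ∀ l : Fin 2, Continuous fun z : (∀ n, S.Digit (i n)) × EuclideanSpace ℝ (Fin 2) =>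
      z.2 l := fun l => by fun_prop
  exact ((isClosed_le h0 (h4 0)).inter (isClosed_le (h4 0) (h0.add h2))).inter
    ((isClosed_le h1 (h4 1)).inter (isClosed_le (h4 1) (h1.add h3)))

/-- Each union of rectangles is the projection of a closed set along the compact space of digit
sequences. -/
theorem isClosed_limitSet (i : ℕ → Fin S.m) : IsClosed (S.limitSet i) := by
  refine isClosed_iInter fun n => ?_
  have h := isClosedMap_snd_of_compactSpace _ (isClosed_setOf_mem_rect (S := S) (i := i) (n + 1))
  convert h using 1
  ext x
  simp

/-- The sequence witnessing membership may vary with the order. For a fixed point the sets of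
witnesses are nested, nonempty and compact, so one sequence serves all orders. -/
theorem limitSet_eq_range_coding (i : ℕ → Fin S.m) : S.limitSet i = Set.range (S.coding i) := by
  ext x
  constructor
  · intro hx
    have hne : (⋂ n, {ω | x ∈ S.rect i ω (n + 1)}).Nonempty := by
      have hcl : ∀ n, IsClosed {ω | x ∈ S.rect i ω (n + 1)} := fun n =>
        (isClosed_setOf_mem_rect (n + 1)).preimage (Continuous.prodMk_left x)
      refine IsCompact.nonempty_iInter_of_sequence_nonempty_isCompact_isClosed _ (fun n ω hω => ?_)
        (fun n => ?_) (hcl 0).isCompact hcl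
      · exact antitone_rect ω (Nat.le_succ _) hω
      · obtain ⟨ω, hω⟩ := Set.mem_iUnion.1 (Set.mem_iInter.1 hx n)
        exact ⟨ω, hω⟩
    obtain ⟨ω, hω⟩ := hne
    refine ⟨ω, (eq_coding ω fun n => ?_).symm⟩
    exact antitone_rect ω (Nat.le_succ _) (Set.mem_iInter.1 hω n)
  · rintro ⟨ω, rfl⟩
    exact Set.mem_iInter.2 fun n => Set.mem_iUnion.2 ⟨ω, coding_mem_rect ω (n + 1)⟩

/-- The corners depend on finitely many digits, so this exhibits the coding map as a limit of
measurable maps. -/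
theorem tendsto_left (ω : ∀ n, S.Digit (i n)) :
    Filter.Tendsto (S.left i ω) Filter.atTop (𝓝 (S.coding i ω 0)) ∧
      Filter.Tendsto (S.bottom i ω) Filter.atTop (𝓝 (S.coding i ω 1)) := by
  obtain ⟨α, β, -, -, hβ0, hβ1, -, hβ⟩ := S.exists_bounds
  have hpow := tendsto_pow_atTop_nhds_zero_of_lt_one hβ0.le hβ1
  have hmem := fun n => (mem_rect_iff ω n _).1 (coding_mem_rect ω n)
  constructor
  · refine tendsto_of_tendsto_of_tendsto_of_le_of_le
      (by simpa using tendsto_const_nhds.sub hpow) tendsto_const_nhds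
      (fun n => ?_) fun n => (hmem n).1.1
    have h1 := (hmem n).1.2
    have h2 := (width_le_height ω n).trans (height_le_pow ω hβ n)
    change S.coding i ω 0 - β ^ n ≤ _
    linarith
  · refine tendsto_of_tendsto_of_tendsto_of_le_of_le
      (by simpa using tendsto_const_nhds.sub hpow) tendsto_const_nhds
      (fun n => ?_) fun n => (hmem n).2.1
    have h1 := (hmem n).2.2
    have h2 := height_le_pow ω hβ n
    change S.coding i ω 1 - β ^ n ≤ _
    linarith

theorem measurable_coding (i : ℕ → Fin S.m) : Measurable (S.coding i) := by
  have hdig : ∀ (l : ℕ) (g : S.Digit (i l) → ℝ), Measurable fun ω : ∀ n, S.Digit (i n) => g (ω l) :=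
    fun l g => (Measurable.of_discrete (f := g)).comp (measurable_pi_apply l)
  have hw : ∀ n, Measurable fun ω => S.width i ω n := fun n =>
    Finset.measurable_prod _ fun l _ => hdig l fun x => S.a (i l) x.1 x.2
  have hh : ∀ n, Measurable fun ω => S.height i ω n := fun n =>
    Finset.measurable_prod _ fun l _ => hdig l fun x => S.b (i l) x.1
  have hl : ∀ n, Measurable fun ω => S.left i ω n := fun n =>
    Finset.measurable_sum _ fun l _ => (hw l).mul (hdig l fun x => S.c (i l) x.1 x.2)
  have hb : ∀ n, Measurable fun ω => S.bottom i ω n := fun n =>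
    Finset.measurable_sum _ fun l _ => (hh l).mul (hdig l fun x => S.d (i l) x.1)
  have h0 : Measurable fun ω => S.coding i ω 0 :=
    measurable_of_tendsto_metrizable hl (tendsto_pi_nhds.2 fun ω => (tendsto_left ω).1)
  have h1 : Measurable fun ω => S.coding i ω 1 :=
    measurable_of_tendsto_metrizable hb (tendsto_pi_nhds.2 fun ω => (tendsto_left ω).2)
  have h : Measurable fun ω => (WithLp.toLp 2 fun l => S.coding i ω l : EuclideanSpace ℝ (Fin 2)) := by
    refine (WithLp.measurable_toLp 2 _).comp (measurable_pi_iff.2 fun l => ?_)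
    fin_cases l
    · exact h0
    · exact h1
  exact h

end Topology

end RandomCarpet

/-! ### Stopping times and approximate squares -/

namespace RandomCarpet

variable (S : RandomCarpet) {i : ℕ → Fin S.m}

/-- The first order at which the width of the basic rectangle is at most `r`. -/
noncomputable def widthTime (ω : ∀ n, S.Digit (i n)) (r : ℝ) : ℕ := sInf {n | S.width i ω n ≤ r}

/-- The first order at which the height of the basic rectangle is at most `r`. -/
noncomputable def heightTime (ω : ∀ n, S.Digit (i n)) (r : ℝ) : ℕ := sInf {n | S.height i ω n ≤ r}

/-- The digit sequences that agree with `ω` in the first `n` digits and in the first `L` rows. -/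
def box (ω : ∀ n, S.Digit (i n)) (n L : ℕ) : Set (∀ n, S.Digit (i n)) :=
  {ω' | (∀ l < n, ω' l = ω l) ∧ ∀ l < L, (ω' l).1 = (ω l).1}

/-- The logarithm of the sum of the `t`-th powers of the widths in a row. -/
noncomputable def logRowSum (t : ℝ) (i : Fin S.m) (j : Fin (S.rows i)) : ℝ :=
  Real.log (∑ k, S.a i j k ^ t)

variable {S}

section StoppingTimes

variable {ω ω' : ∀ n, S.Digit (i n)} {r : ℝ}

theorem exists_height_le (ω : ∀ n, S.Digit (i n)) (hr : 0 < r) : ∃ n, S.height i ω n ≤ r := by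
  obtain ⟨α, β, -, -, hβ0, hβ1, -, hβ⟩ := S.exists_bounds
  obtain ⟨n, hn⟩ := exists_pow_lt_of_lt_one hr hβ1
  exact ⟨n, (height_le_pow ω hβ n).trans hn.le⟩

theorem height_heightTime_le (ω : ∀ n, S.Digit (i n)) (hr : 0 < r) :
    S.height i ω (S.heightTime ω r) ≤ r :=
  Nat.sInf_mem (s := {n | S.height i ω n ≤ r}) (exists_height_le ω hr)

theorem width_widthTime_le (ω : ∀ n, S.Digit (i n)) (hr : 0 < r) :
    S.width i ω (S.widthTime ω r) ≤ r :=
  Nat.sInf_mem (s := {n | S.width i ω n ≤ r})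
    ((exists_height_le ω hr).imp fun n hn => (width_le_height ω n).trans hn)

theorem widthTime_le {n : ℕ} (h : S.width i ω n ≤ r) : S.widthTime ω r ≤ n := Nat.sInf_le h

theorem heightTime_le {n : ℕ} (h : S.height i ω n ≤ r) : S.heightTime ω r ≤ n := Nat.sInf_le h

theorem lt_width {n : ℕ} (h : n < S.widthTime ω r) : r < S.width i ω n :=
  not_le.1 fun hn => Nat.notMem_of_lt_sInf h hn

theorem lt_height {n : ℕ} (h : n < S.heightTime ω r) : r < S.height i ω n :=
  not_le.1 fun hn => Nat.notMem_of_lt_sInf h hn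

theorem widthTime_le_of_height_le {n : ℕ} (h : S.height i ω n ≤ r) : S.widthTime ω r ≤ n :=
  widthTime_le ((width_le_height ω n).trans h)

/-- One step before stopping the width still exceeds `r`, and a step loses at most the factor `α`.
If stopping occurs at order 0, the width is 1 and `r ≤ 1` is used. -/
theorem mul_le_width_widthTime {α : ℝ} (hα : 0 < α) (hα1 : α < 1) (h : ∀ i j k, α ≤ S.a i j k)
    (ω : ∀ n, S.Digit (i n)) (hr1 : r ≤ 1) :
    α * r ≤ S.width i ω (S.widthTime ω r) := by
  rcases hn : S.widthTime ω r with _ | n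
  · rw [width_zero]; nlinarith
  · have hlt : r < S.width i ω n := lt_width (hn ▸ Nat.lt_succ_self n)
    rw [width_succ, mul_comm]
    exact mul_le_mul hlt.le (h _ _ _) hα.le (width_pos ω n).le

theorem mul_le_height_heightTime {α : ℝ} (hα : 0 < α) (hα1 : α < 1) (h : ∀ i j k, α ≤ S.a i j k)
    (ω : ∀ n, S.Digit (i n)) (hr1 : r ≤ 1) :
    α * r ≤ S.height i ω (S.heightTime ω r) := by
  rcases hn : S.heightTime ω r with _ | n
  · rw [height_zero]; nlinarith
  · have hlt : r < S.height i ω n := lt_height (hn ▸ Nat.lt_succ_self n)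
    rw [height_succ, mul_comm]
    exact mul_le_mul hlt.le ((h _ _ (ω n).2).trans (S.a_le_b _ _ _)) hα.le (height_pos ω n).le

/-- The stopping time is determined by the digits read before it, which is what makes boxes stopped
there partition the sequences. -/
theorem widthTime_congr (hr : 0 < r) (h : ∀ l < S.widthTime ω r, ω' l = ω l) :
    S.widthTime ω' r = S.widthTime ω r := by
  refine le_antisymm (widthTime_le ?_) (le_of_not_gt fun hlt => ?_)
  · rw [width_congr h]; exact width_widthTime_le ω hr
  · have h1 := lt_width hlt
    rw [← width_congr fun l hl => h l (hl.trans hlt)] at h1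
    exact (width_widthTime_le ω' hr).not_gt h1

theorem heightTime_congr (hr : 0 < r) (h : ∀ l < S.heightTime ω r, (ω' l).1 = (ω l).1) :
    S.heightTime ω' r = S.heightTime ω r := by
  refine le_antisymm (heightTime_le ?_) (le_of_not_gt fun hlt => ?_)
  · rw [height_congr h]; exact height_heightTime_le ω hr
  · have h1 := lt_height hlt
    rw [← height_congr fun l hl => h l (hl.trans hlt)] at h1
    exact (height_heightTime_le ω' hr).not_gt h1

end StoppingTimes

section Box

variable {ω ω' : ∀ n, S.Digit (i n)} {n L : ℕ}

theorem mem_box_self (ω : ∀ n, S.Digit (i n)) (n L : ℕ) : ω ∈ S.box ω n L :=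
  ⟨fun _ _ => rfl, fun _ _ => rfl⟩

theorem box_eq_of_mem (h : ω' ∈ S.box ω n L) : S.box ω' n L = S.box ω n L := by
  ext ω''
  constructor
  · exact fun h' => ⟨fun l hl => (h'.1 l hl).trans (h.1 l hl), fun l hl => (h'.2 l hl).trans (h.2 l hl)⟩
  · exact fun h' => ⟨fun l hl => (h'.1 l hl).trans (h.1 l hl).symm,
      fun l hl => (h'.2 l hl).trans (h.2 l hl).symm⟩

open Classical in
theorem box_eq_pi (ω : ∀ n, S.Digit (i n)) (hnL : n ≤ L) : S.box ω n L =
    Set.pi (Finset.range L) fun l => if l < n then {ω l} else {x | x.1 = (ω l).1} := by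
  ext ω'
  simp only [box, Set.mem_ofPred_eq, Set.mem_pi, Finset.coe_range, Set.mem_Iio]
  constructor
  · rintro ⟨h1, h2⟩ l hl
    split_ifs with h
    · exact h1 l h
    · exact h2 l hl
  · intro h
    refine ⟨fun l hl => ?_, fun l hl => ?_⟩
    · have := h l (hl.trans_le hnL)
      rwa [if_pos hl] at this
    · have := h l hl
      split_ifs at this with h'
      · rw [Set.mem_singleton_iff.1 this]
      · exact this

theorem measurableSet_box (ω : ∀ n, S.Digit (i n)) (hnL : n ≤ L) :
    MeasurableSet (S.box ω n L) := by
  classical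
  rw [box_eq_pi ω hnL]
  exact MeasurableSet.pi (Finset.countable_toSet _) fun _ _ => MeasurableSet.of_discrete

theorem dist_coding_le {r : ℝ} (hw : S.width i ω n ≤ r) (hh : S.height i ω L ≤ r)
    {ω₁ ω₂ : ∀ n, S.Digit (i n)} (h₁ : ω₁ ∈ S.box ω n L) (h₂ : ω₂ ∈ S.box ω n L) :
    dist (S.coding i ω₁) (S.coding i ω₂) ≤ 2 * r := by
  have key : ∀ ω' ∈ S.box ω n L,
      (S.left i ω n ≤ S.coding i ω' 0 ∧ S.coding i ω' 0 ≤ S.left i ω n + r) ∧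
      (S.bottom i ω L ≤ S.coding i ω' 1 ∧ S.coding i ω' 1 ≤ S.bottom i ω L + r) := by
    intro ω' h'
    have h0 := ((mem_rect_iff ω' n _).1 (coding_mem_rect ω' n)).1
    have h1 := ((mem_rect_iff ω' L _).1 (coding_mem_rect ω' L)).2
    rw [left_congr h'.1, width_congr h'.1] at h0
    rw [bottom_congr h'.2, height_congr h'.2] at h1
    exact ⟨⟨h0.1, by linarith⟩, h1.1, by linarith⟩
  obtain ⟨⟨a1, a2⟩, a3, a4⟩ := key ω₁ h₁
  obtain ⟨⟨b1, b2⟩, b3, b4⟩ := key ω₂ h₂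
  have hr : 0 ≤ r := (width_pos ω n).le.trans hw
  rw [EuclideanSpace.dist_eq, Fin.sum_univ_two, Real.dist_eq, Real.dist_eq, sq_abs, sq_abs]
  refine Real.sqrt_le_iff.2 ⟨by linarith, ?_⟩
  nlinarith

theorem ediam_coding_box_le {r : ℝ} (hw : S.width i ω n ≤ r) (hh : S.height i ω L ≤ r) :
    Metric.ediam (S.coding i '' S.box ω n L) ≤ ENNReal.ofReal (2 * r) := by
  refine Metric.ediam_le ?_
  rintro _ ⟨ω₁, h₁, rfl⟩ _ ⟨ω₂, h₂, rfl⟩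
  rw [edist_dist]
  exact ENNReal.ofReal_le_ofReal (dist_coding_le hw hh h₁ h₂)

variable {q : (i : Fin S.m) → Fin (S.rows i) → ℝ}

/-- The box is a product set: the first `n` coordinates fix a whole digit, the next ones up to `L`
only a row, whose column factors sum to 1. -/
theorem digitMeasure_box (hq : S.IsRowWeight q) (t : ℝ) (ω : ∀ n, S.Digit (i n)) (hnL : n ≤ L) :
    S.digitMeasure q t i (S.box ω n L) = ENNReal.ofReal
      ((∏ l ∈ Finset.range L, q (i l) (ω l).1) * ∏ l ∈ Finset.range n,
        (S.a (i l) (ω l).1 (ω l).2 ^ t / ∑ k, S.a (i l) (ω l).1 k ^ t)) := by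
  classical
  have := isProbabilityMeasure_bernoulliWeight hq t
  have hone : ∀ l (x : S.Digit (i l)), weightedMeasure (S.bernoulliWeight q t (i l)) {x} =
      ENNReal.ofReal (S.bernoulliWeight q t (i l) x) := by
    intro l x
    rw [weightedMeasure_apply _ (bernoulliWeight_nonneg hq t _)]
    simp [Finset.filter_eq']
  have hrow : ∀ l (j : Fin (S.rows (i l))),
      weightedMeasure (S.bernoulliWeight q t (i l)) {x | x.1 = j} = ENNReal.ofReal (q (i l) j) := by
    intro l j
    rw [weightedMeasure_apply _ (bernoulliWeight_nonneg hq t _), Finset.sum_filter,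
      ← sum_bernoulliWeight_row q t (i l) j, Fintype.sum_sigma, Finset.sum_eq_single j]
    · simp
    · intro j' _ hj'
      simp [hj']
    · simp
  rw [box_eq_pi ω hnL, digitMeasure, Measure.infinitePi_pi _ fun _ _ => MeasurableSet.of_discrete]
  have hfac : ∀ l, weightedMeasure (S.bernoulliWeight q t (i l))
      (if l < n then {ω l} else {x | x.1 = (ω l).1}) = ENNReal.ofReal (q (i l) (ω l).1 *
        if l < n then S.a (i l) (ω l).1 (ω l).2 ^ t / ∑ k, S.a (i l) (ω l).1 k ^ t else 1) := by
    intro l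
    split_ifs
    · exact hone l (ω l)
    · rw [hrow, mul_one]
  rw [Finset.prod_congr rfl fun l _ => hfac l, ← ENNReal.ofReal_prod_of_nonneg, Finset.prod_mul_distrib]
  · congr 2
    rw [← Finset.prod_filter]
    congr 1
    ext l
    simp only [Finset.mem_filter, Finset.mem_range]
    omega
  · intro l _
    refine mul_nonneg (hq.nonneg _ _) ?_
    split_ifs
    · exact div_nonneg (Real.rpow_nonneg (S.a_pos _ _ _).le _) (S.rowSum_pos _ _ _).le
    · exact zero_le_one

theorem digitMeasure_box_eq_exp (hq : S.IsRowWeight q) (t : ℝ) (ω : ∀ n, S.Digit (i n))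
    (hnL : n ≤ L) (hpos : ∀ l < L, 0 < q (i l) (ω l).1) :
    S.digitMeasure q t i (S.box ω n L) = ENNReal.ofReal (Real.exp
      (∑ l ∈ Finset.range L, Real.log (q (i l) (ω l).1) + t * Real.log (S.width i ω n) -
        ∑ l ∈ Finset.range n, S.logRowSum t (i l) (ω l).1)) := by
  rw [digitMeasure_box hq t ω hnL, add_sub_assoc, Real.exp_add, Real.exp_sum]
  congr 2
  · exact Finset.prod_congr rfl fun l hl => (Real.exp_log (hpos l (Finset.mem_range.1 hl))).symm
  · rw [log_width, Finset.mul_sum, ← Finset.sum_sub_distrib, Real.exp_sum]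
    refine Finset.prod_congr rfl fun l _ => ?_
    rw [Real.exp_sub, logRowSum, Real.exp_log (S.rowSum_pos _ _ _), mul_comm t,
      ← Real.rpow_def_of_pos (S.a_pos _ _ _)]

end Box

end RandomCarpet

/-! ### Mass distribution and the counting of approximate squares -/

/-- The mass distribution principle. -/
theorem ofReal_le_dimH_of_measure_le {X : Type*} [MetricSpace X] [MeasurableSpace X] [BorelSpace X]
    (ν : Measure X) {d C : ℝ} (hd : 0 < d)
    (h : ∀ (U : Set X) (r : ℝ), 0 < r → r ≤ 1 → Metric.ediam U ≤ ENNReal.ofReal r →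
      ν U ≤ ENNReal.ofReal (C * r ^ d)) {F : Set X} (hF : ν F ≠ 0) :
    ENNReal.ofReal d ≤ dimH F := by
  have hle : (ENNReal.ofReal (|C| + 1))⁻¹ • ν ≤ μH[d] := by
    refine Measure.le_hausdorffMeasure d _ (ENNReal.ofReal 2⁻¹) (by simp) fun U hU => ?_
    have hC : (0 : ℝ) < |C| + 1 := by positivity
    have hfin : Metric.ediam U ≠ ⊤ := ne_top_of_le_ne_top ENNReal.ofReal_ne_top hU
    set x := (Metric.ediam U).toReal with hx
    have hxU : Metric.ediam U = ENNReal.ofReal x := (ENNReal.ofReal_toReal hfin).symm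
    have hx0 : 0 ≤ x := ENNReal.toReal_nonneg
    have hx1 : x ≤ 2⁻¹ := by
      rw [hxU] at hU
      exact (ENNReal.ofReal_le_ofReal_iff (by norm_num)).1 hU
    -- The hypothesis needs a positive radius while the diameter may vanish, so the estimate is
    -- obtained as a limit from larger radii.
    have hlim : Filter.Tendsto (fun r : ℝ => ENNReal.ofReal ((|C| + 1) * r ^ d)) (𝓝[>] x)
        (𝓝 (ENNReal.ofReal ((|C| + 1) * x ^ d))) := by
      refine ENNReal.tendsto_ofReal (Filter.Tendsto.const_mul _ ?_)
      exact ((Real.continuousAt_rpow_const x d (Or.inr hd.le)).tendsto).mono_left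
        nhdsWithin_le_nhds
    have hν : ν U ≤ ENNReal.ofReal ((|C| + 1) * x ^ d) := by
      refine ge_of_tendsto hlim ?_
      filter_upwards [Ioc_mem_nhdsGT (show x < 1 by linarith)] with r hr
      have hr0 : 0 < r := hx0.trans_lt hr.1
      refine (h U r hr0 hr.2 (hxU ▸ ENNReal.ofReal_le_ofReal hr.1.le)).trans
        (ENNReal.ofReal_le_ofReal (mul_le_mul_of_nonneg_right ?_ (Real.rpow_nonneg hr0.le _)))
      linarith [le_abs_self C]
    rw [Measure.smul_apply, smul_eq_mul, hxU, ENNReal.ofReal_rpow_of_nonneg hx0 hd.le]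
    calc (ENNReal.ofReal (|C| + 1))⁻¹ * ν U
        ≤ (ENNReal.ofReal (|C| + 1))⁻¹ * ENNReal.ofReal ((|C| + 1) * x ^ d) := by gcongr
      _ = ENNReal.ofReal (x ^ d) := by
        rw [ENNReal.ofReal_mul hC.le, ← mul_assoc, ENNReal.inv_mul_cancel, one_mul]
        · exact (ENNReal.ofReal_pos.2 hC).ne'
        · exact ENNReal.ofReal_ne_top
  have hne : μH[d] F ≠ 0 := by
    intro h0
    have h1 := (Measure.le_iff'.1 hle F).trans_eq h0
    rw [Measure.smul_apply, smul_eq_mul, nonpos_iff_eq_zero, mul_eq_zero] at h1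
    rcases h1 with h1 | h1
    · exact ENNReal.inv_ne_zero.2 ENNReal.ofReal_ne_top h1
    · exact hF h1
  have := le_dimH_of_hausdorffMeasure_ne_zero (d := ⟨d, hd.le⟩) hne
  rwa [ENNReal.ofReal, Real.toNNReal_of_nonneg hd.le]

namespace RandomCarpet

variable {S : RandomCarpet} {i : ℕ → Fin S.m}

theorem floor_div_lt_floor_div {x y z : ℝ} (hz : 0 < z) (h : x + z ≤ y) :
    ⌊x / z⌋ < ⌊y / z⌋ := by
  have h1 : x / z + 1 ≤ y / z := by
    rw [← div_self hz.ne', ← add_div]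
    exact div_le_div_of_nonneg_right h hz.le
  have h2 : ⌊x / z⌋ + 1 ≤ ⌊y / z⌋ := by
    rw [← Int.floor_add_one]; exact Int.floor_le_floor h1
  omega

/-- The approximate squares of size `r` are separated by the rounded coordinates of their lower
left corners. -/
theorem mem_box_of_floor_eq {α : ℝ} (hα : 0 < α) (hα1 : α < 1) (ha : ∀ i j k, α ≤ S.a i j k)
    {r : ℝ} (hr : 0 < r) (hr1 : r ≤ 1) {ω ω' : ∀ n, S.Digit (i n)}
    (h1 : ⌊S.bottom i ω (S.heightTime ω r) / (α * r)⌋ =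
      ⌊S.bottom i ω' (S.heightTime ω' r) / (α * r)⌋)
    (h0 : ⌊S.left i ω (S.widthTime ω r) / (α * r)⌋ =
      ⌊S.left i ω' (S.widthTime ω' r) / (α * r)⌋) :
    ω' ∈ S.box ω (S.widthTime ω r) (S.heightTime ω r) := by
  classical
  have hαr : 0 < α * r := mul_pos hα hr
  have hrows : ∀ l < S.heightTime ω r, (ω' l).1 = (ω l).1 := by
    by_contra hcon
    have hex : ∃ l, l < S.heightTime ω r ∧ (ω' l).1 ≠ (ω l).1 := by
      push Not at hcon
      exact hcon
    obtain ⟨hl, hne⟩ := Nat.find_spec hex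
    set l := Nat.find hex
    have hbefore : ∀ l' < l, (ω' l').1 = (ω l').1 := by
      intro l' hl'
      have := Nat.find_min hex hl'
      push Not at this
      exact this (hl'.trans hl)
    -- Had `ω'` stopped by order `l`, `ω` would agree with it in all rows read so far and would have
    -- stopped at the same order.
    have hl' : l < S.heightTime ω' r := by
      by_contra hge
      have := heightTime_congr (ω := ω') (ω' := ω) hr fun l' hl' =>
        (hbefore l' (hl'.trans_le (not_lt.1 hge))).symm
      omega
    rcases lt_or_gt_of_ne hne with hlt | hlt
    · have h := bottom_add_height_le hbefore hlt hl' hl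
      have h2 := mul_le_height_heightTime hα hα1 ha ω' hr1
      -- The lower of the two disjoint strips has height at least α * r, so the rounded bottoms
      -- differ.
      exact (floor_div_lt_floor_div hαr (by linarith)).ne' h1
    · have h := bottom_add_height_le (fun l' hl' => (hbefore l' hl').symm) hlt hl hl'
      have h2 := mul_le_height_heightTime hα hα1 ha ω hr1
      exact (floor_div_lt_floor_div hαr (by linarith)).ne h1
  refine ⟨?_, hrows⟩
  by_contra hcon
  have hex : ∃ l, l < S.widthTime ω r ∧ ω' l ≠ ω l := by
    push Not at hcon
    exact hcon
  obtain ⟨hl, hne⟩ := Nat.find_spec hex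
  set l := Nat.find hex
  have hbefore : ∀ l' < l, ω' l' = ω l' := by
    intro l' hl'
    have := Nat.find_min hex hl'
    push Not at this
    exact this (hl'.trans hl)
  have hl' : l < S.widthTime ω' r := by
    by_contra hge
    have := widthTime_congr (ω := ω') (ω' := ω) hr fun l' hl' =>
      (hbefore l' (hl'.trans_le (not_lt.1 hge))).symm
    omega
  -- Widths are at most heights, so the columns stop no later than the rows, where row agreement is
  -- already known.
  have hrow : (ω' l).1 = (ω l).1 :=
    hrows l (hl.trans_le (widthTime_le_of_height_le (height_heightTime_le ω hr)))
  have hcol : ((ω' l).2 : ℕ) ≠ (ω l).2 := by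
    generalize ω' l = x at hne hrow ⊢
    generalize ω l = y at hne hrow ⊢
    obtain ⟨j, k⟩ := x
    obtain ⟨j', k'⟩ := y
    dsimp only at hrow
    subst hrow
    exact fun h => hne (congrArg (Sigma.mk j) (Fin.ext h))
  rcases lt_or_gt_of_ne hcol with hlt | hlt
  · have h := left_add_width_le hbefore hrow hlt hl' hl
    have h2 := mul_le_width_widthTime hα hα1 ha ω' hr1
    exact (floor_div_lt_floor_div hαr (by linarith)).ne' h0
  · have h := left_add_width_le (fun l' hl' => (hbefore l' hl').symm) hrow.symm hlt hl hl'
    have h2 := mul_le_width_widthTime hα hα1 ha ω hr1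
    exact (floor_div_lt_floor_div hαr (by linarith)).ne h0

theorem card_Icc_floor_le (x y z : ℝ) :
    ((Finset.Icc ⌊x / z⌋ ⌊y / z⌋).card : ℝ) ≤ |(y - x) / z| + 2 := by
  rw [Int.card_Icc]
  have h1 := Int.floor_le (y / z)
  have h2 := Int.lt_floor_add_one (x / z)
  have h3 := le_abs_self ((y - x) / z)
  rw [sub_div] at h3 ⊢
  have h4 := abs_nonneg (y / z - x / z)
  rcases le_total 0 (⌊y / z⌋ + 1 - ⌊x / z⌋) with h | h
  · have : (((⌊y / z⌋ + 1 - ⌊x / z⌋).toNat : ℤ) : ℝ) = ⌊y / z⌋ + 1 - ⌊x / z⌋ := by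
      rw [Int.toNat_of_nonneg h]; push_cast; ring
    rw [← Int.cast_natCast, this]
    linarith
  · rw [Int.toNat_of_nonpos h]
    simp only [Nat.cast_zero]
    linarith

/-- If the approximate squares of size `r` around the points of `E` have measure at most `V`, then
the part of `E` that is coded into a set of diameter at most `r` has measure at most a constant
multiple of `V`. -/
theorem exists_measure_inter_preimage_coding_le (S : RandomCarpet) : ∃ K : ℝ, 0 ≤ K ∧
    ∀ (i : ℕ → Fin S.m) (μ : Measure (∀ n, S.Digit (i n))) (E : Set (∀ n, S.Digit (i n)))
      (V r : ℝ), 0 < r → r ≤ 1 →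
      (∀ ω ∈ E, μ (S.box ω (S.widthTime ω r) (S.heightTime ω r)) ≤ ENNReal.ofReal V) →
      ∀ U : Set (EuclideanSpace ℝ (Fin 2)), Metric.ediam U ≤ ENNReal.ofReal r →
        μ (S.coding i ⁻¹' U ∩ E) ≤ ENNReal.ofReal (K * V) := by
  obtain ⟨α, β, hα, hα1, -, -, ha, -⟩ := S.exists_bounds
  refine ⟨(3 / α + 2) * (3 / α + 2), by positivity, fun i μ E V r hr hr1 hE U hU => ?_⟩
  rcases (S.coding i ⁻¹' U ∩ E).eq_empty_or_nonempty with hemp | ⟨ω₀, hω₀U, hω₀E⟩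
  · rw [hemp, measure_empty]; exact bot_le
  have hαr : 0 < α * r := mul_pos hα hr
  -- A coded point of the set lies within r of that of `ω₀`, and its corner at most r below it in
  -- each coordinate. Hence corners lie in a window of length 3 * r, with at most 3 / α + 2 cells of
  -- mesh α * r.
  let cell : Fin 2 → Finset ℤ := fun l =>
    Finset.Icc ⌊(S.coding i ω₀ l - 2 * r) / (α * r)⌋ ⌊(S.coding i ω₀ l + r) / (α * r)⌋
  let key : (∀ n, S.Digit (i n)) → ℤ × ℤ := fun ω =>
    (⌊S.bottom i ω (S.heightTime ω r) / (α * r)⌋, ⌊S.left i ω (S.widthTime ω r) / (α * r)⌋)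
  have hcard : ∀ l, ((cell l).card : ℝ) ≤ 3 / α + 2 := by
    intro l
    refine (card_Icc_floor_le _ _ _).trans_eq ?_
    have : (S.coding i ω₀ l + r - (S.coding i ω₀ l - 2 * r)) / (α * r) = 3 / α := by
      field_simp; ring
    rw [this, abs_of_pos (by positivity)]
  have hkey : ∀ ω ∈ S.coding i ⁻¹' U ∩ E, key ω ∈ cell 1 ×ˢ cell 0 := by
    rintro ω ⟨hωU, -⟩
    have hdist : dist (S.coding i ω) (S.coding i ω₀) ≤ r := by
      have := (Metric.edist_le_ediam_of_mem (show S.coding i ω ∈ U from hωU) hω₀U).trans hU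
      rw [edist_dist] at this
      exact (ENNReal.ofReal_le_ofReal_iff hr.le).1 this
    have hcoord : ∀ l, |S.coding i ω l - S.coding i ω₀ l| ≤ r := fun l => by
      have h := PiLp.norm_apply_le (S.coding i ω - S.coding i ω₀) l
      rw [← dist_eq_norm] at h
      exact h.trans hdist
    have h0 := ((mem_rect_iff ω (S.widthTime ω r) _).1 (coding_mem_rect ω _)).1
    have h1 := ((mem_rect_iff ω (S.heightTime ω r) _).1 (coding_mem_rect ω _)).2
    have hw := width_widthTime_le ω hr
    have hh := height_heightTime_le ω hr
    have c0 := abs_le.1 (hcoord 0)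
    have c1 := abs_le.1 (hcoord 1)
    simp only [key, cell, Finset.mem_product, Finset.mem_Icc]
    refine ⟨⟨?_, ?_⟩, ?_, ?_⟩ <;>
      exact Int.floor_le_floor (div_le_div_of_nonneg_right (by linarith) hαr.le)
  have hcover : S.coding i ⁻¹' U ∩ E ⊆
      ⋃ κ ∈ cell 1 ×ˢ cell 0, {ω ∈ S.coding i ⁻¹' U ∩ E | key ω = κ} := by
    intro ω hω
    exact Set.mem_biUnion (hkey ω hω) ⟨hω, rfl⟩
  have hpiece : ∀ κ, μ {ω ∈ S.coding i ⁻¹' U ∩ E | key ω = κ} ≤ ENNReal.ofReal V := by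
    intro κ
    rcases Set.eq_empty_or_nonempty {ω ∈ S.coding i ⁻¹' U ∩ E | key ω = κ} with he | ⟨ω, hω, hωκ⟩
    · rw [he, measure_empty]; exact bot_le
    · refine (measure_mono fun ω' hω' => ?_).trans (hE ω hω.2)
      have hk := hωκ.trans hω'.2.symm
      exact mem_box_of_floor_eq hα hα1 ha hr hr1 (congrArg Prod.fst hk) (congrArg Prod.snd hk)
  calc μ (S.coding i ⁻¹' U ∩ E)
      ≤ ∑ κ ∈ cell 1 ×ˢ cell 0, μ {ω ∈ S.coding i ⁻¹' U ∩ E | key ω = κ} :=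
        (measure_mono hcover).trans (measure_biUnion_finset_le _ _)
    _ ≤ ∑ κ ∈ cell 1 ×ˢ cell 0, ENNReal.ofReal V := Finset.sum_le_sum fun κ _ => hpiece κ
    _ = ENNReal.ofReal (((cell 1).card * (cell 0).card : ℕ) : ℝ) * ENNReal.ofReal V := by
        rw [Finset.sum_const, Finset.card_product, nsmul_eq_mul, ENNReal.ofReal_natCast]
    _ ≤ ENNReal.ofReal ((3 / α + 2) * (3 / α + 2)) * ENNReal.ofReal V := by
        gcongr
        push_cast
        exact mul_le_mul (hcard 1) (hcard 0) (Nat.cast_nonneg _) (by positivity)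
    _ = ENNReal.ofReal ((3 / α + 2) * (3 / α + 2) * V) :=
        (ENNReal.ofReal_mul (by positivity)).symm

end RandomCarpet

/-! ### Lower bound for the dimension of Bernoulli measures -/

namespace RandomCarpet

variable {S : RandomCarpet} {i : ℕ → Fin S.m}

theorem isRowWeight_div (P : S.weights) : S.IsRowWeight fun i j => P.1 i j / S.p i where
  nonneg i j := div_nonneg (P.2.1 i j) (S.p_pos i).le
  sum_eq i := by rw [← Finset.sum_div, P.2.2 i, div_self (S.p_pos i).ne']

theorem p_mul_sum_div (P : S.weights) (g : (i : Fin S.m) → Fin (S.rows i) → ℝ) :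
    ∑ i, S.p i * ∑ j, P.1 i j / S.p i * g i j = ∑ i, ∑ j, P.1 i j * g i j := by
  refine Finset.sum_congr rfl fun i _ => ?_
  rw [Finset.mul_sum]
  refine Finset.sum_congr rfl fun j _ => ?_
  have := (S.p_pos i).ne'
  field_simp

theorem fibreDim_mem (P : S.weights) : S.fibreDim P ∈ Set.Icc (0 : ℝ) 1 :=
  (S.existsUnique_fibreDim P).choose_spec.1.1

theorem sum_logRowSum_fibreDim (P : S.weights) :
    ∑ i, ∑ j, P.1 i j * S.logRowSum (S.fibreDim P) i j = 0 :=
  (S.existsUnique_fibreDim P).choose_spec.1.2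

theorem sum_mul_log_b_neg (P : S.weights) : ∑ i, ∑ j, P.1 i j * Real.log (S.b i j) < 0 := by
  refine Finset.sum_neg (fun i _ => ?_) ⟨⟨0, S.m_pos⟩, Finset.mem_univ _⟩
  have hlog : ∀ j, Real.log (S.b i j) < 0 := fun j => Real.log_neg (b_pos i j) (S.b_lt_one i j)
  by_contra hcon
  have hz := (Finset.sum_eq_zero_iff_of_nonpos fun j _ =>
    mul_nonpos_of_nonneg_of_nonpos (P.2.1 i j) (hlog j).le).1
    (le_antisymm (Finset.sum_nonpos fun j _ =>
      mul_nonpos_of_nonneg_of_nonpos (P.2.1 i j) (hlog j).le) (not_lt.1 hcon))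
  have h0 : ∑ j, P.1 i j = 0 := Finset.sum_eq_zero fun j hj =>
    (mul_eq_zero.1 (hz j hj)).resolve_right (hlog j).ne
  exact (S.p_pos i).ne' (P.2.2 i ▸ h0)

theorem sum_mul_log_div (P : S.weights) : ∑ i, ∑ j, P.1 i j * Real.log (P.1 i j / S.p i) =
    ∑ i, ∑ j, P.1 i j * Real.log (P.1 i j) - ∑ i, S.p i * Real.log (S.p i) := by
  rw [← Finset.sum_sub_distrib]
  refine Finset.sum_congr rfl fun i _ => ?_
  have h : ∀ j, P.1 i j * Real.log (P.1 i j / S.p i) =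
      P.1 i j * Real.log (P.1 i j) - P.1 i j * Real.log (S.p i) := by
    intro j
    rcases eq_or_ne (P.1 i j) 0 with h0 | h0
    · simp [h0]
    · rw [Real.log_div h0 (S.p_pos i).ne']; ring
  rw [Finset.sum_congr rfl fun j _ => h j, Finset.sum_sub_distrib, ← Finset.sum_mul, P.2.2 i]

/-- The relative entropy of the rows is the vertical dimension times the vertical exponent. -/
theorem baseDim_mul (P : S.weights) : S.baseDim P * ∑ i, ∑ j, P.1 i j * Real.log (S.b i j) =
    ∑ i, ∑ j, P.1 i j * Real.log (P.1 i j / S.p i) := by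
  rw [sum_mul_log_div, baseDim, div_mul_cancel₀ _ (sum_mul_log_b_neg P).ne]

theorem baseDim_nonneg (P : S.weights) : 0 ≤ S.baseDim P := by
  rw [baseDim, ← sum_mul_log_div]
  refine div_nonneg_of_nonpos (Finset.sum_nonpos fun i _ => Finset.sum_nonpos fun j _ => ?_)
    (sum_mul_log_b_neg P).le
  refine mul_nonpos_of_nonneg_of_nonpos (P.2.1 i j) (Real.log_nonpos
    ((isRowWeight_div P).nonneg i j) ?_)
  rw [div_le_one (S.p_pos i), ← P.2.2 i]
  exact Finset.single_le_sum (fun j _ => P.2.1 i j) (Finset.mem_univ j)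

/-- The number of steps down to scale `r` is of order log(1 / r), so an error κ per step costs only
a multiple of κ in the exponent. -/
theorem heightTime_mul_le {β : ℝ} (hβ0 : 0 < β) (hβ1 : β < 1) (hβ : ∀ i j, S.b i j ≤ β)
    (ω : ∀ n, S.Digit (i n)) {r : ℝ} (hr : 0 < r) (hr1 : r ≤ 1) :
    (S.heightTime ω r : ℝ) * -Real.log β ≤ -Real.log β - Real.log r := by
  have hlogβ := Real.log_neg hβ0 hβ1
  rcases hL : S.heightTime ω r with _ | L
  · have := Real.log_nonpos hr.le hr1
    simp only [Nat.cast_zero, zero_mul]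
    linarith
  · have h : r < β ^ L :=
      (lt_height (hL ▸ Nat.lt_succ_self L)).trans_le (height_le_pow ω hβ L)
    have h2 := Real.log_lt_log hr h
    rw [Real.log_pow] at h2
    push_cast
    linarith

/-- The digit sequences along which two row functions have sums that grow at most like
`κ * n + M`. -/
def sumsBounded (i : ℕ → Fin S.m) (g g' : (i : Fin S.m) → Fin (S.rows i) → ℝ) (κ M : ℝ) :
    Set (∀ n, S.Digit (i n)) :=
  {ω | ∀ n : ℕ, ∑ l ∈ Finset.range n, g (i l) (ω l).1 ≤ κ * n + M ∧
    ∑ l ∈ Finset.range n, g' (i l) (ω l).1 ≤ κ * n + M}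

/-- An Egorov-type uniformity: almost surely the bounds hold eventually, and a constant `M` absorbs
the finitely many earlier orders. Countably many such sets cover almost everything, so one of them
is not null. -/
theorem exists_measure_sumsBounded_ne_zero {q : (i : Fin S.m) → Fin (S.rows i) → ℝ}
    (hq : S.IsRowWeight q) (t : ℝ) (hi : S.Typical i)
    {g g' : (i : Fin S.m) → Fin (S.rows i) → ℝ} (hg : ∑ i, S.p i * ∑ j, q i j * g i j ≤ 0)
    (hg' : ∑ i, S.p i * ∑ j, q i j * g' i j ≤ 0) {κ : ℝ} (hκ : 0 < κ) :
    ∃ M : ℕ, S.digitMeasure q t i (sumsBounded i g g' κ M) ≠ 0 := by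
  have := isProbabilityMeasure_digitMeasure hq t i
  by_contra! hcon
  have hnull : S.digitMeasure q t i (⋃ M : ℕ, sumsBounded i g g' κ M) = 0 :=
    measure_iUnion_null hcon
  have hfull : ∀ᵐ ω ∂S.digitMeasure q t i, ω ∈ ⋃ M : ℕ, sumsBounded i g g' κ M := by
    filter_upwards [ae_eventually_rowSum_le hq t hi g hg hκ,
      ae_eventually_rowSum_le hq t hi g' hg' hκ] with ω h1 h2
    obtain ⟨n₀, hn₀⟩ := Filter.eventually_atTop.1 (h1.and h2)
    obtain ⟨M, hM⟩ := exists_nat_ge (∑ n ∈ Finset.range n₀,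
      (|∑ l ∈ Finset.range n, g (i l) (ω l).1| + |∑ l ∈ Finset.range n, g' (i l) (ω l).1|))
    refine Set.mem_iUnion.2 ⟨M, fun n => ?_⟩
    have hκn : 0 ≤ κ * n := by positivity
    rcases lt_or_ge n n₀ with hn | hn
    · have h := (Finset.single_le_sum (f := fun n => |∑ l ∈ Finset.range n, g (i l) (ω l).1| +
        |∑ l ∈ Finset.range n, g' (i l) (ω l).1|) (fun _ _ => by positivity)
        (Finset.mem_range.2 hn)).trans hM
      have a1 := le_abs_self (∑ l ∈ Finset.range n, g (i l) (ω l).1)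
      have a2 := le_abs_self (∑ l ∈ Finset.range n, g' (i l) (ω l).1)
      have a3 := abs_nonneg (∑ l ∈ Finset.range n, g (i l) (ω l).1)
      have a4 := abs_nonneg (∑ l ∈ Finset.range n, g' (i l) (ω l).1)
      constructor <;> linarith
    · have hM0 : (0 : ℝ) ≤ M := Nat.cast_nonneg M
      obtain ⟨b1, b2⟩ := hn₀ n hn
      constructor <;> linarith
  have hcompl : S.digitMeasure q t i (⋃ M : ℕ, sumsBounded i g g' κ M)ᶜ = 0 := hfull
  have huniv := measure_union_null hnull hcompl
  rw [Set.union_compl_self, measure_univ] at huniv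
  exact one_ne_zero huniv

/-- One bounded sum gives the entropy in terms of λ(P) * log(height), the other removes the
normalising row sums. The two errors κ per step, over at most 1 + log r / log β steps, lower the
exponent by 2 * κ / (-log β). -/
theorem digitMeasure_square_le (P : S.weights) {β : ℝ} (hβ0 : 0 < β) (hβ1 : β < 1)
    (hβ : ∀ i j, S.b i j ≤ β) {κ M : ℝ} (hκ : 0 < κ) {ω : ∀ n, S.Digit (i n)}
    (hω : ω ∈ sumsBounded i (fun i j => -S.logRowSum (S.fibreDim P) i j)
      (fun i j => Real.log (P.1 i j / S.p i) - S.baseDim P * Real.log (S.b i j)) κ M)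
    {r : ℝ} (hr : 0 < r) (hr1 : r ≤ 1) :
    S.symbolicMeasure P i (S.box ω (S.widthTime ω r) (S.heightTime ω r)) ≤ ENNReal.ofReal
      (Real.exp (2 * κ + 2 * M) *
        r ^ (S.baseDim P + S.fibreDim P - 2 * κ / -Real.log β)) := by
  set q : (i : Fin S.m) → Fin (S.rows i) → ℝ := fun i j => P.1 i j / S.p i
  set t := S.fibreDim P
  have hq : S.IsRowWeight q := isRowWeight_div P
  set n := S.widthTime ω r
  set L := S.heightTime ω r
  have hnL : n ≤ L := widthTime_le_of_height_le (height_heightTime_le ω hr)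
  change S.digitMeasure q t i (S.box ω n L) ≤ _
  -- Logarithms require positive row probabilities; a square through a row of probability zero is
  -- null.
  by_cases hpos : ∀ l < L, 0 < q (i l) (ω l).1
  · rw [digitMeasure_box_eq_exp hq t ω hnL hpos, Real.rpow_def_of_pos hr, ← Real.exp_add]
    refine ENNReal.ofReal_le_ofReal (Real.exp_le_exp.2 ?_)
    have h1 := (hω n).1
    have h2 := (hω L).2
    rw [Finset.sum_neg_distrib] at h1
    rw [Finset.sum_sub_distrib, ← Finset.mul_sum, ← log_height] at h2
    have h3 : S.baseDim P * Real.log (S.height i ω L) ≤ S.baseDim P * Real.log r :=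
      mul_le_mul_of_nonneg_left (Real.log_le_log (height_pos ω L) (height_heightTime_le ω hr))
        (baseDim_nonneg P)
    have h4 : t * Real.log (S.width i ω n) ≤ t * Real.log r :=
      mul_le_mul_of_nonneg_left (Real.log_le_log (width_pos ω n) (width_widthTime_le ω hr))
        (fibreDim_mem P).1
    have hB : 0 < -Real.log β := neg_pos.2 (Real.log_neg hβ0 hβ1)
    have h5 : (L : ℝ) ≤ 1 - Real.log r / -Real.log β := by
      have := heightTime_mul_le hβ0 hβ1 hβ ω hr hr1
      rw [← le_div_iff₀ hB, sub_div, div_self hB.ne'] at this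
      exact this
    have h6 : κ * (n : ℝ) ≤ κ * L := mul_le_mul_of_nonneg_left (Nat.cast_le.2 hnL) hκ.le
    have h7 : κ * (L : ℝ) ≤ κ * (1 - Real.log r / -Real.log β) :=
      mul_le_mul_of_nonneg_left h5 hκ.le
    have h8 : Real.log r * (S.baseDim P + t - 2 * κ / -Real.log β) =
        S.baseDim P * Real.log r + t * Real.log r - 2 * (κ * (Real.log r / -Real.log β)) := by
      ring
    rw [h8]
    linarith
  · push Not at hpos
    obtain ⟨l, hl, hql⟩ := hpos
    rw [digitMeasure_box hq t ω hnL, Finset.prod_eq_zero (Finset.mem_range.2 hl)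
      (le_antisymm hql (hq.nonneg _ _)), zero_mul, ENNReal.ofReal_zero]
    exact bot_le

/-- The Bernoulli measure of `P` has at least the expected dimension. -/
theorem le_measureDimH_bernoulli (hi : S.Typical i) (P : S.weights) :
    ENNReal.ofReal (S.baseDim P + S.fibreDim P) ≤ measureDimH (S.bernoulli P i) := by
  refine le_iInf₂ fun F hF => le_iInf fun hF1 => ?_
  suffices H : ∀ d : ℝ, 0 < d → d < S.baseDim P + S.fibreDim P →
      ENNReal.ofReal d ≤ dimH F by
    refine le_of_forall_lt fun c hc => ?_
    have hctop : c ≠ ⊤ := (hc.trans ENNReal.ofReal_lt_top).ne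
    have hc' := (ENNReal.lt_ofReal_iff_toReal_lt hctop).1 hc
    obtain ⟨d, hd1, hd2⟩ := exists_between hc'
    have hd0 : 0 < d := ENNReal.toReal_nonneg.trans_lt hd1
    exact ((ENNReal.lt_ofReal_iff_toReal_lt hctop).2 hd1).trans_le (H d hd0 hd2)
  intro d hd0 hd
  obtain ⟨K, hK0, hK⟩ := S.exists_measure_inter_preimage_coding_le
  obtain ⟨α, β, -, -, hβ0, hβ1, -, hβ⟩ := S.exists_bounds
  have hB : 0 < -Real.log β := neg_pos.2 (Real.log_neg hβ0 hβ1)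
  -- Chosen so that the exponent left after the loss is exactly `d`.
  set κ : ℝ := -Real.log β * (S.baseDim P + S.fibreDim P - d) / 2 with hκdef
  have hκ : 0 < κ := by
    have : 0 < S.baseDim P + S.fibreDim P - d := by linarith
    positivity
  have hexp : S.baseDim P + S.fibreDim P - 2 * κ / -Real.log β = d := by
    have := neg_ne_zero.1 hB.ne'
    rw [hκdef]; field_simp; ring
  obtain ⟨M, hM⟩ := exists_measure_sumsBounded_ne_zero (isRowWeight_div P) (S.fibreDim P) hi
    (g := fun i j => -S.logRowSum (S.fibreDim P) i j)
    (g' := fun i j => Real.log (P.1 i j / S.p i) - S.baseDim P * Real.log (S.b i j))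
    (by
      rw [p_mul_sum_div]
      simp only [mul_neg, Finset.sum_neg_distrib, sum_logRowSum_fibreDim, neg_zero, le_refl])
    (by
      rw [p_mul_sum_div]
      simp only [mul_sub, Finset.sum_sub_distrib]
      have h := baseDim_mul P
      simp only [Finset.mul_sum] at h
      simp only [mul_left_comm] at h ⊢
      rw [h, sub_self]) hκ
  set E := sumsBounded i (fun i j => -S.logRowSum (S.fibreDim P) i j)
    (fun i j => Real.log (P.1 i j / S.p i) - S.baseDim P * Real.log (S.b i j)) κ (M : ℝ)
  have hprob : IsProbabilityMeasure (S.symbolicMeasure P i) := by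
    unfold symbolicMeasure; infer_instance
  have hcod := S.measurable_coding i
  have hνmeas : ∀ U, MeasurableSet U → ((S.symbolicMeasure P i).restrict E).map (S.coding i) U =
      S.symbolicMeasure P i (S.coding i ⁻¹' U ∩ E) := fun U hU => by
    rw [Measure.map_apply hcod hU, Measure.restrict_apply (hcod hU)]
  refine ofReal_le_dimH_of_measure_le (((S.symbolicMeasure P i).restrict E).map (S.coding i))
    (C := K * Real.exp (2 * κ + 2 * M)) hd0 (fun U r hr hr1 hU => ?_) ?_
  -- The closure is measurable and has the same diameter.
  · refine (measure_mono subset_closure).trans ?_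
    rw [hνmeas _ isClosed_closure.measurableSet, mul_assoc]
    refine hK i _ E _ r hr hr1 (fun ω hω => ?_) _ (by rwa [Metric.ediam_closure])
    have h := digitMeasure_square_le P hβ0 hβ1 hβ hκ hω hr hr1
    rwa [hexp] at h
  · rw [hνmeas F hF]
    rw [bernoulli, Measure.map_apply hcod hF] at hF1
    have hc : S.symbolicMeasure P i (S.coding i ⁻¹' F)ᶜ = 0 :=
      (prob_compl_eq_zero_iff (hcod hF)).2 hF1
    intro h0
    refine hM (measure_mono_null (fun ω hω => ?_) (measure_union_null h0 hc))
    by_cases h : ω ∈ S.coding i ⁻¹' F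
    · exact Or.inl ⟨h, hω⟩
    · exact Or.inr h

end RandomCarpet

/-! ### Covering criterion for vanishing Hausdorff measure -/

/-- A function on sequences of letters from finite alphabets that only depends on the first `N`
letters has countable range. -/
theorem countable_range_of_eq_of_forall_lt {α : ℕ → Type} [∀ n, Finite (α n)] {γ : Type*}
    (f : (∀ n, α n) → γ) (N : ℕ) (hf : ∀ ω ω' : ∀ n, α n, (∀ l < N, ω l = ω' l) → f ω = f ω') :
    (Set.range f).Countable := by
  rcases isEmpty_or_nonempty (∀ n, α n) with h | ⟨⟨ω₀⟩⟩
  · rw [Set.range_eq_empty]; exact Set.countable_empty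
  · let res : (∀ n, α n) → (∀ l : Fin N, α l) := fun ω l => ω l
    have hfac : f.FactorsThrough res := fun ω ω' h =>
      hf ω ω' fun l hl => congrFun h ⟨l, hl⟩
    refine (Set.countable_range (Function.extend res f fun _ => f ω₀)).mono ?_
    rintro _ ⟨ω, rfl⟩
    exact ⟨res ω, hfac.extend_apply _ ω⟩

/-- A set that can be covered infinitely often by images of atoms of countable partitions which
carry a geometrically small multiple of the mass of the atoms has Hausdorff measure zero. -/
theorem hausdorffMeasure_image_eq_zero_of_frequently {Ω X : Type*} [MeasurableSpace Ω]
    [MetricSpace X] [MeasurableSpace X] [BorelSpace X] (μ : Measure Ω) [IsProbabilityMeasure μ]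
    (𝒬 : ℕ → Set (Set Ω)) (hcount : ∀ N, (𝒬 N).Countable) (hdisj : ∀ N, (𝒬 N).PairwiseDisjoint id)
    (hmeas : ∀ N, ∀ A ∈ 𝒬 N, MeasurableSet A) (f : Ω → X) (δ : ℕ → ENNReal) (hδ : Antitone δ)
    (hδ0 : Filter.Tendsto δ Filter.atTop (𝓝 0))
    (hdiam : ∀ N, ∀ A ∈ 𝒬 N, Metric.ediam (f '' A) ≤ δ N) {s C θ : ℝ} (hC : 0 ≤ C) (hθ0 : 0 ≤ θ)
    (hθ1 : θ < 1) (E : Set Ω)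
    (hE : ∀ ω ∈ E, ∃ᶠ N in Filter.atTop, ∃ A ∈ 𝒬 N, ω ∈ A ∧
      Metric.ediam (f '' A) ^ s ≤ ENNReal.ofReal (C * θ ^ N) * μ A) :
    μH[s] (f '' E) = 0 := by
  let good : ℕ → Set (Set Ω) := fun N =>
    {A ∈ 𝒬 N | Metric.ediam (f '' A) ^ s ≤ ENNReal.ofReal (C * θ ^ N) * μ A}
  have hgood : ∀ N, (good N).Countable := fun N => (hcount N).mono fun A hA => hA.1
  have : ∀ N, Countable (good N) := fun N => (hgood N).to_subtype
  -- The cover number `M` consists of all good atoms of levels at least `M`. Atoms of one level are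
  -- disjoint with total mass at most 1, so the levels contribute the tail of a geometric series.
  have hle := Measure.hausdorffMeasure_le_liminf_tsum (l := Filter.atTop) s (f '' E) δ hδ0
    (ι := fun M : ℕ => Σ k : ℕ, good (M + k)) (fun M x => f '' x.2.1)
    (Filter.Eventually.of_forall fun M x =>
      (hdiam _ _ x.2.2.1).trans (hδ (Nat.le_add_right M x.1)))
    (Filter.Eventually.of_forall fun M => by
      rintro _ ⟨ω, hω, rfl⟩
      obtain ⟨N, hN, A, hA, hωA, hAs⟩ := Filter.frequently_atTop.1 (hE ω hω) M
      obtain ⟨k, rfl⟩ := Nat.exists_eq_add_of_le hN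
      exact Set.mem_iUnion.2 ⟨⟨k, A, hA, hAs⟩, ω, hωA, rfl⟩)
  have hsum : ∀ M : ℕ, ∑' x : Σ k : ℕ, good (M + k), Metric.ediam (f '' x.2.1) ^ s ≤
      ENNReal.ofReal (C * θ ^ M * (1 - θ)⁻¹) := by
    intro M
    rw [ENNReal.tsum_sigma' fun x : Σ k : ℕ, good (M + k) => Metric.ediam (f '' x.2.1) ^ s]
    have hk : ∀ k : ℕ, ∑' A : good (M + k), Metric.ediam (f '' A.1) ^ s ≤
        ENNReal.ofReal (C * θ ^ M * θ ^ k) := by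
      intro k
      calc ∑' A : good (M + k), Metric.ediam (f '' A.1) ^ s
          ≤ ∑' A : good (M + k), ENNReal.ofReal (C * θ ^ (M + k)) * μ A.1 :=
            ENNReal.tsum_le_tsum fun A => A.2.2
        _ = ENNReal.ofReal (C * θ ^ (M + k)) * ∑' A : good (M + k), μ A.1 := ENNReal.tsum_mul_left
        _ ≤ ENNReal.ofReal (C * θ ^ (M + k)) * 1 := by
            gcongr
            have h := measure_biUnion (μ := μ) (f := id) (hgood (M + k))
              ((hdisj (M + k)).subset fun A hA => hA.1) fun A hA => hmeas _ _ hA.1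
            simp only [id] at h
            rw [← h]
            exact prob_le_one
        _ = ENNReal.ofReal (C * θ ^ M * θ ^ k) := by rw [mul_one, pow_add, mul_assoc]
    refine (ENNReal.tsum_le_tsum hk).trans_eq ?_
    rw [← ENNReal.ofReal_tsum_of_nonneg (fun k => by positivity)
      ((summable_geometric_of_lt_one hθ0 hθ1).mul_left _), tsum_mul_left,
      tsum_geometric_of_lt_one hθ0 hθ1]
  have hlim : Filter.Tendsto (fun M : ℕ => ENNReal.ofReal (C * θ ^ M * (1 - θ)⁻¹)) Filter.atTop
      (𝓝 0) := by
    rw [← ENNReal.ofReal_zero]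
    refine ENNReal.tendsto_ofReal ?_
    simpa using ((tendsto_pow_atTop_nhds_zero_of_lt_one hθ0 hθ1).const_mul C).mul_const (1 - θ)⁻¹
  refine le_antisymm (hle.trans ?_) bot_le
  rw [← hlim.liminf_eq]
  exact Filter.liminf_le_liminf (Filter.Eventually.of_forall hsum)

/-! ### Partitions into approximate squares -/

namespace RandomCarpet

variable {S : RandomCarpet} {i : ℕ → Fin S.m}

/-- The approximate square around `ω` whose height is fixed by the first `N` rows. -/
def squareAt (ω : ∀ n, S.Digit (i n)) (N : ℕ) : Set (∀ n, S.Digit (i n)) :=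
  S.box ω (S.widthTime ω (S.height i ω N)) N

theorem squareAt_eq_of_agree {ω ω' : ∀ n, S.Digit (i n)} {N : ℕ}
    (h : ∀ l < S.widthTime ω (S.height i ω N), ω' l = ω l) (h' : ∀ l < N, (ω' l).1 = (ω l).1) :
    squareAt ω' N = squareAt ω N := by
  rw [squareAt, height_congr h', widthTime_congr (height_pos ω N) h]
  exact box_eq_of_mem ⟨h, h'⟩

theorem widthTime_height_le (ω : ∀ n, S.Digit (i n)) (N : ℕ) :
    S.widthTime ω (S.height i ω N) ≤ N :=
  widthTime_le_of_height_le le_rfl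

theorem countable_range_squareAt (i : ℕ → Fin S.m) (N : ℕ) :
    (Set.range fun ω : ∀ n, S.Digit (i n) => squareAt ω N).Countable := by
  refine countable_range_of_eq_of_forall_lt _ N fun ω ω' h => ?_
  exact squareAt_eq_of_agree (fun l hl => h l (hl.trans_le (widthTime_height_le _ _)))
    fun l hl => by rw [h l hl]

/-- Indexing by the number of rows instead of by scale makes the squares of one level atoms of a
partition: each square is the same seen from any of its members. -/
theorem pairwiseDisjoint_squareAt (i : ℕ → Fin S.m) (N : ℕ) :
    (Set.range fun ω : ∀ n, S.Digit (i n) => squareAt ω N).PairwiseDisjoint id := by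
  rintro _ ⟨ω₁, rfl⟩ _ ⟨ω₂, rfl⟩ hne
  refine Set.disjoint_left.2 fun ω h1 h2 => hne ?_
  exact (squareAt_eq_of_agree h1.1 h1.2).symm.trans (squareAt_eq_of_agree h2.1 h2.2)

end RandomCarpet

/-! ### Gibbs measures and critical sets -/

namespace RandomCarpet

variable {S : RandomCarpet} {i : ℕ → Fin S.m}

/-- The sum over a row family of `b ^ u * exp (ρ * logRowSum t)`. -/
noncomputable def partitionSum (S : RandomCarpet) (u ρ t : ℝ) (i : Fin S.m) : ℝ :=
  ∑ j, Real.exp (u * Real.log (S.b i j) + ρ * S.logRowSum t i j)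

/-- The Gibbs row probabilities with potential `u * log b + ρ * logRowSum t`. -/
noncomputable def gibbsWeight (S : RandomCarpet) (u ρ t : ℝ) (i : Fin S.m) (j : Fin (S.rows i)) :
    ℝ :=
  Real.exp (u * Real.log (S.b i j) + ρ * S.logRowSum t i j) / S.partitionSum u ρ t i

theorem partitionSum_pos (u ρ t : ℝ) (i : Fin S.m) : 0 < S.partitionSum u ρ t i :=
  Finset.sum_pos (fun _ _ => Real.exp_pos _) ⟨⟨0, S.rows_pos i⟩, Finset.mem_univ _⟩

theorem gibbsWeight_pos (u ρ t : ℝ) (i : Fin S.m) (j : Fin (S.rows i)) :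
    0 < S.gibbsWeight u ρ t i j :=
  div_pos (Real.exp_pos _) (partitionSum_pos u ρ t i)

theorem isRowWeight_gibbsWeight (u ρ t : ℝ) : S.IsRowWeight (S.gibbsWeight u ρ t) where
  nonneg i j := (gibbsWeight_pos u ρ t i j).le
  sum_eq i := by
    simp only [gibbsWeight]
    rw [← Finset.sum_div]
    exact div_self (partitionSum_pos u ρ t i).ne'

theorem log_gibbsWeight (u ρ t : ℝ) (i : Fin S.m) (j : Fin (S.rows i)) :
    Real.log (S.gibbsWeight u ρ t i j) =
      u * Real.log (S.b i j) + ρ * S.logRowSum t i j - Real.log (S.partitionSum u ρ t i) := by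
  rw [gibbsWeight, Real.log_div (Real.exp_pos _).ne' (partitionSum_pos u ρ t i).ne', Real.log_exp]

/-- The digit sequences for which the sums of `logRowSum t` are infinitely often nonnegative but
never grow faster than `κ * n`. -/
def criticalSet (i : ℕ → Fin S.m) (t κ : ℝ) : Set (∀ n, S.Digit (i n)) :=
  {ω | (∃ᶠ N : ℕ in Filter.atTop, 0 ≤ ∑ l ∈ Finset.range N, S.logRowSum t (i l) (ω l).1) ∧
    ∀ᶠ n : ℕ in Filter.atTop, ∑ l ∈ Finset.range n, S.logRowSum t (i l) (ω l).1 ≤ κ * n}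

/-- In the logarithm of the Gibbs measure, the sum multiplied by `ρ` runs over `N` steps and is
nonnegative, while the subtracted sum runs over the `n ≤ N` steps of the width time and is at most κ
* N; the normalisation costs at most η * N. As N ≤ log r / log β, the measure is at least a constant
times r ^ s', and the surplus s - s' supplies the geometric factor. -/
theorem ediam_squareAt_rpow_le {α β u ρ t η κ s : ℝ} (hα : 0 < α) (hα1 : α < 1) (hβ0 : 0 < β)
    (hβ1 : β < 1) (ha : ∀ i j k, α ≤ S.a i j k) (hβ : ∀ i j, S.b i j ≤ β) (ht : 0 ≤ t)
    (hρ : 0 ≤ ρ) (hη : 0 ≤ η) (hκ : 0 ≤ κ) (hs0 : 0 ≤ s)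
    (hs : u + t + (η + κ) / -Real.log β ≤ s) {ω : ∀ n, S.Digit (i n)} {N : ℕ}
    (hN : 0 ≤ ∑ l ∈ Finset.range N, S.logRowSum t (i l) (ω l).1)
    (hn : ∑ l ∈ Finset.range (S.widthTime ω (S.height i ω N)), S.logRowSum t (i l) (ω l).1 ≤
      κ * S.widthTime ω (S.height i ω N))
    (hZ : ∑ l ∈ Finset.range N, Real.log (S.partitionSum u ρ t (i l)) ≤ η * N) :
    Metric.ediam (S.coding i '' squareAt ω N) ^ s ≤
      ENNReal.ofReal (2 ^ s * Real.exp (-(t * Real.log α)) *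
        (β ^ (s - (u + t + (η + κ) / -Real.log β))) ^ N) *
      S.digitMeasure (S.gibbsWeight u ρ t) t i (squareAt ω N) := by
  set r := S.height i ω N with hr
  set n := S.widthTime ω r
  set s' := u + t + (η + κ) / -Real.log β with hs'
  have hr0 : 0 < r := height_pos ω N
  have hrβ : r ≤ β ^ N := height_le_pow ω hβ N
  have hr1 : r ≤ 1 := hrβ.trans (pow_le_one₀ hβ0.le hβ1.le)
  have hnN : n ≤ N := widthTime_height_le ω N
  have hB : 0 < -Real.log β := neg_pos.2 (Real.log_neg hβ0 hβ1)
  have hlogr : Real.log r ≤ N * Real.log β := by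
    rw [← Real.log_pow]; exact Real.log_le_log hr0 hrβ
  have hmeas : ENNReal.ofReal (Real.exp (t * Real.log α) * r ^ s') ≤
      S.digitMeasure (S.gibbsWeight u ρ t) t i (squareAt ω N) := by
    rw [squareAt, digitMeasure_box_eq_exp (isRowWeight_gibbsWeight u ρ t) t ω hnN
      fun l _ => gibbsWeight_pos u ρ t _ _, Real.rpow_def_of_pos hr0, ← Real.exp_add]
    refine ENNReal.ofReal_le_ofReal (Real.exp_le_exp.2 ?_)
    simp only [log_gibbsWeight]
    rw [Finset.sum_sub_distrib, Finset.sum_add_distrib, ← Finset.mul_sum, ← Finset.mul_sum,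
      ← log_height, ← hr]
    have h1 : t * (Real.log α + Real.log r) ≤ t * Real.log (S.width i ω n) := by
      rw [← Real.log_mul hα.ne' hr0.ne']
      exact mul_le_mul_of_nonneg_left (Real.log_le_log (mul_pos hα hr0)
        (mul_le_width_widthTime hα hα1 ha ω hr1)) ht
    have h2 := mul_nonneg hρ hN
    have h3 : κ * (n : ℝ) ≤ κ * N := mul_le_mul_of_nonneg_left (Nat.cast_le.2 hnN) hκ
    have h4 : (η + κ) * (N : ℝ) ≤ -(Real.log r * ((η + κ) / -Real.log β)) := by
      have h5 : (N : ℝ) ≤ -Real.log r / -Real.log β := by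
        rw [le_div_iff₀ hB]; linarith
      refine (mul_le_mul_of_nonneg_left h5 (add_nonneg hη hκ)).trans_eq ?_
      ring
    have h6 : Real.log r * s' = u * Real.log r + t * Real.log r +
        Real.log r * ((η + κ) / -Real.log β) := by rw [hs']; ring
    rw [h6]
    linarith
  have hdiam : Metric.ediam (S.coding i '' squareAt ω N) ≤ ENNReal.ofReal (2 * r) :=
    ediam_coding_box_le (width_widthTime_le ω hr0) le_rfl
  have hrs : r ^ s ≤ r ^ s' * (β ^ (s - s')) ^ N := by
    have h1 : r ^ s = r ^ s' * r ^ (s - s') := by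
      rw [← Real.rpow_add hr0]; congr 1; ring
    rw [h1, ← Real.rpow_natCast, ← Real.rpow_mul hβ0.le, mul_comm (s - s'), Real.rpow_mul hβ0.le,
      Real.rpow_natCast]
    exact mul_le_mul_of_nonneg_left (Real.rpow_le_rpow hr0.le hrβ (sub_nonneg.2 hs))
      (Real.rpow_nonneg hr0.le _)
  calc Metric.ediam (S.coding i '' squareAt ω N) ^ s
      ≤ ENNReal.ofReal (2 * r) ^ s := ENNReal.rpow_le_rpow hdiam hs0
    _ = ENNReal.ofReal (2 ^ s * r ^ s) := by
        rw [ENNReal.ofReal_rpow_of_nonneg (by positivity) hs0, Real.mul_rpow zero_le_two hr0.le]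
    _ ≤ ENNReal.ofReal (2 ^ s * Real.exp (-(t * Real.log α)) * (β ^ (s - s')) ^ N *
          (Real.exp (t * Real.log α) * r ^ s')) := by
        refine ENNReal.ofReal_le_ofReal ?_
        have h : 2 ^ s * Real.exp (-(t * Real.log α)) * (β ^ (s - s')) ^ N *
            (Real.exp (t * Real.log α) * r ^ s') = 2 ^ s * (r ^ s' * (β ^ (s - s')) ^ N) := by
          rw [Real.exp_neg]
          have := (Real.exp_pos (t * Real.log α)).ne'
          field_simp
        rw [h]
        exact mul_le_mul_of_nonneg_left hrs (by positivity)
    _ = ENNReal.ofReal (2 ^ s * Real.exp (-(t * Real.log α)) * (β ^ (s - s')) ^ N) *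
          ENNReal.ofReal (Real.exp (t * Real.log α) * r ^ s') :=
        ENNReal.ofReal_mul (by positivity)
    _ ≤ _ := by gcongr

/-- Lets the bound defining `criticalSet`, valid for large orders, be used at the width time of a
large square. -/
theorem tendsto_widthTime_height (ω : ∀ n, S.Digit (i n)) :
    Filter.Tendsto (fun N => S.widthTime ω (S.height i ω N)) Filter.atTop Filter.atTop := by
  obtain ⟨α, β, hα, hα1, hβ0, hβ1, ha, hβ⟩ := S.exists_bounds
  refine Filter.tendsto_atTop.2 fun n₀ => ?_
  filter_upwards [(tendsto_pow_atTop_nhds_zero_of_lt_one hβ0.le hβ1).eventually_lt_const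
    (pow_pos hα n₀)] with N hN
  by_contra! hlt
  have h1 := (pow_le_width ω hα ha _).trans (width_widthTime_le ω (height_pos ω N))
  have h2 := height_le_pow ω hβ N
  have h3 : α ^ n₀ ≤ α ^ S.widthTime ω (S.height i ω N) :=
    pow_le_pow_of_le_one hα.le hα1.le hlt.le
  linarith

/-- One η bounds the pressure; the second is the slack with which the averages of log Z along the
typical environment approach it. -/
theorem dimH_coding_criticalSet_le (hi : S.Typical i) {β u ρ t η κ s : ℝ} (hβ0 : 0 < β)
    (hβ1 : β < 1) (hβ : ∀ i j, S.b i j ≤ β) (ht : 0 ≤ t) (hρ : 0 ≤ ρ) (hη : 0 < η) (hκ : 0 ≤ κ)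
    (hs0 : 0 ≤ s) (hs : u + t + (2 * η + κ) / -Real.log β < s)
    (hZ : ∑ i, S.p i * Real.log (S.partitionSum u ρ t i) ≤ η) :
    dimH (S.coding i '' criticalSet i t κ) ≤ ENNReal.ofReal s := by
  obtain ⟨α, -, hα, hα1, -, -, ha, -⟩ := S.exists_bounds
  have := isProbabilityMeasure_digitMeasure (isRowWeight_gibbsWeight (S := S) u ρ t) t i
  have hpow := tendsto_pow_atTop_nhds_zero_of_lt_one hβ0.le hβ1
  have hzero : μH[s] (S.coding i '' criticalSet i t κ) = 0 := by
    refine hausdorffMeasure_image_eq_zero_of_frequently (S.digitMeasure (S.gibbsWeight u ρ t) t i)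
      (fun N => Set.range fun ω : ∀ n, S.Digit (i n) => squareAt ω N)
      (countable_range_squareAt i) (pairwiseDisjoint_squareAt i) ?_ (S.coding i)
      (fun N => ENNReal.ofReal (2 * β ^ N)) ?_ ?_ ?_
      (C := 2 ^ s * Real.exp (-(t * Real.log α)))
      (θ := β ^ (s - (u + t + (2 * η + κ) / -Real.log β))) (by positivity) (by positivity)
      (Real.rpow_lt_one hβ0.le hβ1 (sub_pos.2 hs)) _ ?_
    · rintro N _ ⟨ω, rfl⟩
      exact measurableSet_box ω (widthTime_height_le ω N)
    · intro N N' h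
      exact ENNReal.ofReal_le_ofReal (mul_le_mul_of_nonneg_left
        (pow_le_pow_of_le_one hβ0.le hβ1.le h) zero_le_two)
    · rw [← ENNReal.ofReal_zero]
      refine ENNReal.tendsto_ofReal ?_
      simpa using hpow.const_mul 2
    · rintro N _ ⟨ω, rfl⟩
      refine ediam_coding_box_le ?_ (height_le_pow ω hβ N)
      exact (width_widthTime_le ω (height_pos ω N)).trans (height_le_pow ω hβ N)
    · rintro ω ⟨hω1, hω2⟩
      have hZ' := hi (fun x => Real.log (S.partitionSum u ρ t x)) η hη
      refine ((hω1.and_eventually ((tendsto_widthTime_height ω).eventually hω2)).and_eventually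
        hZ').mono ?_
      rintro N ⟨⟨hN, hn⟩, hZN⟩
      refine ⟨squareAt ω N, ⟨ω, rfl⟩, mem_box_self ω _ _, ?_⟩
      refine ediam_squareAt_rpow_le hα hα1 hβ0 hβ1 ha hβ ht hρ (by positivity) hκ hs0 hs.le hN hn
        (hZN.trans (mul_le_mul_of_nonneg_right ?_ (Nat.cast_nonneg _)))
      linarith
  rw [ENNReal.ofReal, Real.toNNReal_of_nonneg hs0]
  refine dimH_le_of_hausdorffMeasure_ne_top (?_ : μH[s] _ ≠ ⊤)
  rw [hzero]
  exact ENNReal.zero_ne_top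

end RandomCarpet

/-! ### Existence of a maximising vector -/

namespace RandomCarpet

variable {S : RandomCarpet} {i : ℕ → Fin S.m}

theorem logRowSum_le_add {β : ℝ} (hβ0 : 0 < β) (hβ : ∀ i j, S.b i j ≤ β) {t t' : ℝ} (h : t ≤ t')
    (i : Fin S.m) (j : Fin (S.rows i)) :
    S.logRowSum t' i j ≤ S.logRowSum t i j + (t' - t) * Real.log β := by
  rw [logRowSum, logRowSum, ← Real.log_rpow hβ0, ← Real.log_mul (S.rowSum_pos t i j).ne'
    (Real.rpow_pos_of_pos hβ0 _).ne']
  refine Real.log_le_log (S.rowSum_pos t' i j) ?_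
  rw [Finset.sum_mul]
  refine Finset.sum_le_sum fun k _ => ?_
  have ha := S.a_pos i j k
  rw [show t' = t + (t' - t) by ring, Real.rpow_add ha, add_sub_cancel_left]
  exact mul_le_mul_of_nonneg_left (Real.rpow_le_rpow ha.le
    ((S.a_le_b i j k).trans (hβ i j)) (sub_nonneg.2 h)) (Real.rpow_nonneg ha.le _)

theorem logRowSum_add_le {α : ℝ} (hα : 0 < α) (ha : ∀ i j k, α ≤ S.a i j k) {t t' : ℝ}
    (h : t ≤ t') (i : Fin S.m) (j : Fin (S.rows i)) :
    S.logRowSum t i j + (t' - t) * Real.log α ≤ S.logRowSum t' i j := by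
  rw [logRowSum, logRowSum, ← Real.log_rpow hα, ← Real.log_mul (S.rowSum_pos t i j).ne'
    (Real.rpow_pos_of_pos hα _).ne']
  refine Real.log_le_log (mul_pos (S.rowSum_pos t i j) (Real.rpow_pos_of_pos hα _)) ?_
  rw [Finset.sum_mul]
  refine Finset.sum_le_sum fun k _ => ?_
  have hapos := S.a_pos i j k
  rw [show S.a i j k ^ t' = S.a i j k ^ t * S.a i j k ^ (t' - t) by
    rw [← Real.rpow_add hapos]; congr 1; ring]
  exact mul_le_mul_of_nonneg_left (Real.rpow_le_rpow hα.le (ha i j k) (sub_nonneg.2 h))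
    (Real.rpow_nonneg hapos.le _)

theorem logRowSum_zero_nonneg (i : Fin S.m) (j : Fin (S.rows i)) : 0 ≤ S.logRowSum 0 i j := by
  refine Real.log_nonneg ?_
  simpa using Nat.one_le_iff_ne_zero.2 (S.cols_pos i j).ne'

theorem logRowSum_one_nonpos (i : Fin S.m) (j : Fin (S.rows i)) : S.logRowSum 1 i j ≤ 0 := by
  refine Real.log_nonpos (S.rowSum_pos 1 i j).le ?_
  simpa using S.a_sum i j

/-- The weighted sum decreases strictly in the exponent and vanishes at t(P), so a nonnegative value
cannot occur beyond it. -/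
theorem le_fibreDim (P : S.weights) {t : ℝ} (ht : 0 ≤ ∑ i, ∑ j, P.1 i j * S.logRowSum t i j) :
    t ≤ S.fibreDim P := by
  by_contra! hlt
  obtain ⟨α, β, -, -, hβ0, hβ1, -, hβ⟩ := S.exists_bounds
  have hsum : ∑ i, ∑ j, P.1 i j = 1 := by
    rw [Finset.sum_congr rfl fun i _ => P.2.2 i, S.p_sum]
  have hle : ∑ i, ∑ j, P.1 i j * S.logRowSum t i j ≤
      ∑ i, ∑ j, P.1 i j * S.logRowSum (S.fibreDim P) i j + (t - S.fibreDim P) * Real.log β := by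
    rw [← one_mul ((t - S.fibreDim P) * Real.log β), ← hsum, Finset.sum_mul,
      ← Finset.sum_add_distrib]
    refine Finset.sum_le_sum fun i _ => ?_
    rw [Finset.sum_mul, ← Finset.sum_add_distrib]
    refine Finset.sum_le_sum fun j _ => ?_
    rw [← mul_add]
    exact mul_le_mul_of_nonneg_left (logRowSum_le_add hβ0 hβ hlt.le i j) (P.2.1 i j)
  rw [sum_logRowSum_fibreDim, zero_add] at hle
  have := mul_neg_of_pos_of_neg (sub_pos.2 hlt) (Real.log_neg hβ0 hβ1)
  linarith

instance compactSpace_weights (S : RandomCarpet) : CompactSpace S.weights := by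
  refine isCompact_iff_compactSpace.1 ?_
  have hbox : IsCompact (Set.univ.pi fun i => Set.univ.pi fun _ : Fin (S.rows i) =>
      Set.Icc (0 : ℝ) 1) :=
    isCompact_univ_pi fun i => isCompact_univ_pi fun _ => isCompact_Icc
  refine hbox.of_isClosed_subset ?_ fun P hP i _ j _ => ⟨hP.1 i j, ?_⟩
  · have h : S.weights = (⋂ i, ⋂ j, {P | 0 ≤ P i j}) ∩ ⋂ i, {P | ∑ j, P i j = S.p i} := by
      ext P; simp [weights]
    rw [h]
    refine IsClosed.inter (isClosed_iInter fun i => isClosed_iInter fun j =>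
      isClosed_le continuous_const (by fun_prop)) (isClosed_iInter fun i =>
      isClosed_eq (by fun_prop) continuous_const)
  · calc P i j ≤ ∑ j, P i j := Finset.single_le_sum (fun j _ => hP.1 i j) (Finset.mem_univ j)
      _ = S.p i := hP.2 i
      _ ≤ ∑ i, S.p i := Finset.single_le_sum (fun i _ => (S.p_pos i).le) (Finset.mem_univ i)
      _ = 1 := S.p_sum

theorem continuous_weights_apply (i : Fin S.m) (j : Fin (S.rows i)) :
    Continuous fun P : S.weights => P.1 i j :=
  (continuous_apply j).comp ((continuous_apply i).comp continuous_subtype_val)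

theorem continuous_sum_weights_mul (g : (i : Fin S.m) → Fin (S.rows i) → ℝ) :
    Continuous fun P : S.weights => ∑ i, ∑ j, P.1 i j * g i j :=
  continuous_finsetSum _ fun i _ => continuous_finsetSum _ fun j _ =>
    (continuous_weights_apply i j).mul continuous_const

theorem continuous_baseDim (S : RandomCarpet) : Continuous S.baseDim := by
  refine Continuous.div (Continuous.sub ?_ continuous_const) (continuous_sum_weights_mul _)
    fun P => (sum_mul_log_b_neg P).ne
  refine continuous_finsetSum _ fun i _ => continuous_finsetSum _ fun j _ => ?_
  exact Real.continuous_mul_log.comp (continuous_weights_apply i j)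

theorem continuous_logRowSum (i : Fin S.m) (j : Fin (S.rows i)) :
    Continuous fun t => S.logRowSum t i j :=
  Continuous.log (continuous_finsetSum _ fun k _ => Real.continuous_const_rpow (S.a_pos i j k).ne')
    fun t => (S.rowSum_pos t i j).ne'

/-- The weights with given row probabilities. -/
def IsRowWeight.toWeights {q : (i : Fin S.m) → Fin (S.rows i) → ℝ} (hq : S.IsRowWeight q) :
    S.weights :=
  ⟨fun i j => S.p i * q i j, fun i j => mul_nonneg (S.p_pos i).le (hq.nonneg i j),
    fun i => by rw [← Finset.mul_sum, hq.sum_eq, mul_one]⟩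

/-- Maximising P, t ↦ λ(P) + t over the graph of t(P), a compact set as the zero set of a continuous
equation, avoids proving that t(P) is continuous. -/
theorem exists_isMax_dim (S : RandomCarpet) :
    ∃ P : S.weights, ∀ Q : S.weights, S.baseDim Q + S.fibreDim Q ≤ S.baseDim P + S.fibreDim P := by
  set K : Set (S.weights × ℝ) := (Set.univ ×ˢ Set.Icc (0 : ℝ) 1) ∩
    {z | ∑ i, ∑ j, z.1.1 i j * S.logRowSum z.2 i j = 0}
  have hK : IsCompact K := by
    refine (isCompact_univ.prod isCompact_Icc).inter_right (isClosed_eq ?_ continuous_const)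
    refine continuous_finsetSum _ fun i _ => continuous_finsetSum _ fun j _ =>
      ((continuous_weights_apply i j).comp continuous_fst).mul
        ((continuous_logRowSum i j).comp continuous_snd)
  have hmem : ∀ P : S.weights, (P, S.fibreDim P) ∈ K := fun P =>
    ⟨⟨trivial, fibreDim_mem P⟩, sum_logRowSum_fibreDim P⟩
  have hcont : Continuous fun z : S.weights × ℝ => S.baseDim z.1 + z.2 :=
    (S.continuous_baseDim.comp continuous_fst).add continuous_snd
  obtain ⟨⟨P, t⟩, hP, hmax⟩ := hK.exists_isMaxOn
    -- Zero parameters give uniform rows in each family; only nonemptiness matters.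
    ⟨_, hmem (isRowWeight_gibbsWeight 0 0 0).toWeights⟩ hcont.continuousOn
  refine ⟨P, fun Q => (hmax (hmem Q)).trans_eq ?_⟩
  have ht : t = S.fibreDim P := (S.existsUnique_fibreDim P).unique ⟨hP.1.2, hP.2⟩
    (S.existsUnique_fibreDim P).choose_spec.1
  rw [← ht]

end RandomCarpet

/-! ### Duality and the upper bound -/

namespace RandomCarpet

variable {S : RandomCarpet} {i : ℕ → Fin S.m}

/-- The vector of weights given by the Gibbs row probabilities. -/
noncomputable def gibbs (S : RandomCarpet) (u ρ t : ℝ) : S.weights :=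
  (isRowWeight_gibbsWeight u ρ t).toWeights

theorem continuous_gibbs_apply (u t : ℝ) (i : Fin S.m) (j : Fin (S.rows i)) :
    Continuous fun ρ => (S.gibbs u ρ t).1 i j := by
  refine continuous_const.mul (Continuous.div (by fun_prop) ?_ fun ρ =>
    (partitionSum_pos u ρ t i).ne')
  unfold partitionSum
  fun_prop

/-- The pressure in terms of the dimension of the Gibbs weights. -/
theorem sum_log_partitionSum (u ρ t : ℝ) : ∑ i, S.p i * Real.log (S.partitionSum u ρ t i) =
    (S.baseDim (S.gibbs u ρ t) - u) *
      -(∑ i, ∑ j, (S.gibbs u ρ t).1 i j * Real.log (S.b i j)) +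
      ρ * ∑ i, ∑ j, (S.gibbs u ρ t).1 i j * S.logRowSum t i j := by
  set P := S.gibbs u ρ t
  have hent : ∑ i, ∑ j, P.1 i j * Real.log (P.1 i j / S.p i) =
      u * ∑ i, ∑ j, P.1 i j * Real.log (S.b i j) + ρ * ∑ i, ∑ j, P.1 i j * S.logRowSum t i j -
        ∑ i, S.p i * Real.log (S.partitionSum u ρ t i) := by
    rw [Finset.mul_sum, Finset.mul_sum, ← Finset.sum_add_distrib, ← Finset.sum_sub_distrib]
    refine Finset.sum_congr rfl fun i _ => ?_
    have h : ∀ j, P.1 i j * Real.log (P.1 i j / S.p i) =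
        u * (P.1 i j * Real.log (S.b i j)) + ρ * (P.1 i j * S.logRowSum t i j) -
          P.1 i j * Real.log (S.partitionSum u ρ t i) := by
      intro j
      have hdiv : P.1 i j / S.p i = S.gibbsWeight u ρ t i j :=
        mul_div_cancel_left₀ _ (S.p_pos i).ne'
      rw [hdiv, log_gibbsWeight]
      ring
    rw [Finset.sum_congr rfl fun j _ => h j, Finset.sum_sub_distrib, Finset.sum_add_distrib,
      ← Finset.mul_sum, ← Finset.mul_sum, ← Finset.sum_mul, P.2.2 i]
  rw [← baseDim_mul] at hent
  linarith

/-- Duality: below the maximal dimension there are Gibbs weights with a nonnegative multiplier of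
almost nonpositive pressure. -/
theorem exists_sum_log_partitionSum_le {δ t η : ℝ} (hη : 0 < η)
    (hδ : ∀ Q : S.weights, S.baseDim Q + S.fibreDim Q ≤ δ) :
    ∃ ρ : ℝ, 0 ≤ ρ ∧ ∑ i, S.p i * Real.log (S.partitionSum (δ - t) ρ t i) ≤ η := by
  by_contra! hcon
  set D : ℝ → ℝ := fun ρ => ∑ i, ∑ j, (S.gibbs (δ - t) ρ t).1 i j * S.logRowSum t i j
  let H : S.weights → ℝ := fun P =>
    (S.baseDim P - (δ - t)) * -(∑ i, ∑ j, P.1 i j * Real.log (S.b i j))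
  have hpressure : ∀ ρ : ℝ, 0 ≤ ρ → η < H (S.gibbs (δ - t) ρ t) + ρ * D ρ := fun ρ hρ =>
    (hcon ρ hρ).trans_eq (sum_log_partitionSum (δ - t) ρ t)
  -- The constraint gives t ≤ t(P), so λ(P) ≤ δ - t(P) ≤ δ - t.
  have hHnonpos : ∀ P : S.weights, 0 ≤ ∑ i, ∑ j, P.1 i j * S.logRowSum t i j → H P ≤ 0 := by
    intro P hP
    have h1 := le_fibreDim P hP
    have h2 := hδ P
    exact mul_nonpos_of_nonpos_of_nonneg (by linarith) (neg_nonneg.2 (sum_mul_log_b_neg P).le)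
  have hDcont : Continuous D :=
    continuous_finsetSum _ fun i _ => continuous_finsetSum _ fun j _ =>
      (continuous_gibbs_apply (δ - t) t i j).mul continuous_const
  -- If the constraint held at some multiplier, complementary slackness would be attainable: either
  -- it holds at 0, or continuity yields a multiplier with D = 0. The pressure there equals H ≤ 0, a
  -- contradiction.
  have hDneg : ∀ ρ : ℝ, 0 ≤ ρ → D ρ < 0 := by
    intro R hR
    by_contra! hDR
    obtain ⟨ρ, hρ, hρD, hρ0⟩ : ∃ ρ : ℝ, 0 ≤ ρ ∧ 0 ≤ D ρ ∧ ρ * D ρ = 0 := by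
      rcases le_total 0 (D 0) with h0 | h0
      · exact ⟨0, le_rfl, h0, zero_mul _⟩
      · obtain ⟨ρ, hρ, hρ0⟩ := intermediate_value_Icc hR hDcont.continuousOn ⟨h0, hDR⟩
        exact ⟨ρ, hρ.1, hρ0.ge, by rw [hρ0, mul_zero]⟩
    have h1 := hpressure ρ hρ
    have h2 := hHnonpos _ hρD
    rw [hρ0] at h1
    linarith
  have hHcont : Continuous H :=
    ((S.continuous_baseDim).sub continuous_const).mul (continuous_sum_weights_mul _).neg
  -- With D negative throughout, let the multiplier tend to infinity. Since H is bounded and H + ρ *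
  -- D > η, the limit vector satisfies D ≥ 0; since ρ * D ≤ 0, it also satisfies H ≥ η. These are
  -- incompatible.
  obtain ⟨P, -, φ, hφ, hlim⟩ := isCompact_univ.tendsto_subseq
    (x := fun n : ℕ => S.gibbs (δ - t) n t) fun _ => Set.mem_univ _
  obtain ⟨C, hC⟩ := (isCompact_univ.image hHcont).bddAbove
  have hHlim := (hHcont.tendsto P).comp hlim
  have hDlim := ((continuous_sum_weights_mul fun i j => S.logRowSum t i j).tendsto P).comp hlim
  have hDP : 0 ≤ ∑ i, ∑ j, P.1 i j * S.logRowSum t i j := by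
    have hinv : Filter.Tendsto (fun n : ℕ => -|C| / (φ n : ℝ)) Filter.atTop (𝓝 0) :=
      tendsto_const_nhds.div_atTop
        (tendsto_natCast_atTop_atTop.comp hφ.tendsto_atTop)
    refine le_of_tendsto_of_tendsto hinv hDlim ?_
    filter_upwards [hφ.tendsto_atTop.eventually_ge_atTop 1] with n hn
    have hpos : (0 : ℝ) < φ n := by exact_mod_cast hn
    have h1 := hpressure (φ n) hpos.le
    have h2 : H (S.gibbs (δ - t) (φ n) t) ≤ C := hC ⟨_, trivial, rfl⟩
    change -|C| / (φ n : ℝ) ≤ D (φ n)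
    rw [div_le_iff₀ hpos]
    have := le_abs_self C
    linarith
  have hHP : η ≤ H P := by
    refine ge_of_tendsto' hHlim fun n => ?_
    have hpos : (0 : ℝ) ≤ φ n := Nat.cast_nonneg _
    have h1 := hpressure (φ n) hpos
    have h2 := mul_nonpos_of_nonneg_of_nonpos hpos (hDneg _ hpos).le
    change η ≤ H (S.gibbs (δ - t) (φ n) t)
    linarith
  linarith [hHnonpos P hDP]

/-- The largest grid exponent whose sums are infinitely often nonnegative works: 0 qualifies, as
each row has a map. At the next grid point the sums are eventually negative, and one grid step
changes each term by at most κ. At exponent 1 all terms are nonpositive. -/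
theorem exists_mem_criticalSet {α κ : ℝ} (hα : 0 < α) (ha : ∀ i j k, α ≤ S.a i j k) (hκ : 0 ≤ κ)
    {M : ℕ} (hM0 : 0 < M) (hM : -Real.log α / M ≤ κ) (ω : ∀ n, S.Digit (i n)) :
    ∃ k ≤ M, ω ∈ criticalSet i ((k : ℝ) / M) κ := by
  classical
  let p : ℕ → Prop := fun k => ∃ᶠ N : ℕ in Filter.atTop,
    0 ≤ ∑ l ∈ Finset.range N, S.logRowSum ((k : ℝ) / M) (i l) (ω l).1
  have hp0 : p 0 := (Filter.Eventually.of_forall fun N => Finset.sum_nonneg fun l _ => by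
    simpa using logRowSum_zero_nonneg (S := S) (i l) (ω l).1).frequently
  have hM' : (0 : ℝ) < M := by exact_mod_cast hM0
  refine ⟨Nat.findGreatest p M, Nat.findGreatest_le M,
    Nat.findGreatest_spec (P := p) (Nat.zero_le M) hp0, ?_⟩
  set k := Nat.findGreatest p M with hk
  rcases (Nat.findGreatest_le (P := p) M).lt_or_eq with hlt | heq
  · have hnot : ¬ p (k + 1) := Nat.findGreatest_is_greatest (Nat.lt_succ_self _) hlt
    filter_upwards [Filter.not_frequently.1 hnot] with n hn
    rw [not_le] at hn
    have hstep : ∀ l, S.logRowSum ((k : ℝ) / M) (i l) (ω l).1 ≤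
        S.logRowSum (((k + 1 : ℕ) : ℝ) / M) (i l) (ω l).1 + κ := by
      intro l
      have h := logRowSum_add_le (S := S) hα ha (t := (k : ℝ) / M) (t' := ((k + 1 : ℕ) : ℝ) / M)
        (by push_cast; gcongr; linarith) (i l) (ω l).1
      have h' : (((k + 1 : ℕ) : ℝ) / M - (k : ℝ) / M) * Real.log α = -(-Real.log α / M) := by
        push_cast; field_simp; ring
      rw [h'] at h
      linarith
    have hsum := Finset.sum_le_sum fun l (_ : l ∈ Finset.range n) => hstep l
    rw [Finset.sum_add_distrib, Finset.sum_const, Finset.card_range, nsmul_eq_mul] at hsum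
    linarith
  · refine Filter.Eventually.of_forall fun n => ?_
    rw [← hk] at heq
    rw [heq, div_self hM'.ne']
    exact (Finset.sum_nonpos fun l _ => logRowSum_one_nonpos _ _).trans (by positivity)

/-- The dimension of the random set is at most the maximal dimension of the Bernoulli measures. -/
theorem dimH_limitSet_le (hi : S.Typical i) {δ : ℝ} (hδ0 : 0 ≤ δ)
    (hδ : ∀ Q : S.weights, S.baseDim Q + S.fibreDim Q ≤ δ) :
    dimH (S.limitSet i) ≤ ENNReal.ofReal δ := by
  suffices H : ∀ s : ℝ, δ < s → dimH (S.limitSet i) ≤ ENNReal.ofReal s by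
    refine ge_of_tendsto (x := 𝓝[>] δ) (f := ENNReal.ofReal)
      (ENNReal.continuous_ofReal.continuousAt.tendsto.mono_left nhdsWithin_le_nhds) ?_
    filter_upwards [self_mem_nhdsWithin] with s hs using H s hs
  intro s hs
  obtain ⟨α, β, hα, hα1, hβ0, hβ1, ha, hβ⟩ := S.exists_bounds
  have hB : 0 < -Real.log β := neg_pos.2 (Real.log_neg hβ0 hβ1)
  -- The exponent loss 3 * κ / (-log β) is then three quarters of s - δ.
  set κ := -Real.log β * (s - δ) / 4 with hκdef
  have hκ : 0 < κ := by
    have := sub_pos.2 hs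
    positivity
  have hκs : (2 * κ + κ) / -Real.log β < s - δ := by
    rw [div_lt_iff₀ hB]
    have : 0 < (s - δ) * -Real.log β := mul_pos (sub_pos.2 hs) hB
    linarith
  obtain ⟨M, hM⟩ := exists_nat_gt (max 0 (-Real.log α / κ))
  have hM0' : (0 : ℝ) < M := (le_max_left _ _).trans_lt hM
  have hM0 : 0 < M := by exact_mod_cast hM0'
  have hMκ : -Real.log α / M ≤ κ := by
    have h := ((le_max_right _ _).trans_lt hM).le
    rw [div_le_iff₀ hκ] at h
    rw [div_le_iff₀ hM0']
    linarith
  have hcover : S.limitSet i ⊆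
      ⋃ k : Fin (M + 1), S.coding i '' criticalSet i (((k : ℕ) : ℝ) / M) κ := by
    rw [limitSet_eq_range_coding]
    rintro _ ⟨ω, rfl⟩
    obtain ⟨k, hk, hω⟩ := exists_mem_criticalSet hα ha hκ.le hM0 hMκ ω
    exact Set.mem_iUnion.2 ⟨⟨k, Nat.lt_succ_of_le hk⟩, ω, hω, rfl⟩
  refine (dimH_mono hcover).trans ?_
  rw [dimH_iUnion]
  refine iSup_le fun k => ?_
  obtain ⟨ρ, hρ, hZ⟩ := exists_sum_log_partitionSum_le (t := ((k : ℕ) : ℝ) / M) hκ hδ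
  exact dimH_coding_criticalSet_le hi hβ0 hβ1 hβ (by positivity) hρ hκ hκ.le (hδ0.trans hs.le)
    (by linarith) hZ

/-- The limit set is closed and contains every coded point, so it competes in the infimum. -/
theorem measureDimH_bernoulli_le (P : S.weights) (i : ℕ → Fin S.m) :
    measureDimH (S.bernoulli P i) ≤ dimH (S.limitSet i) := by
  have hprob : IsProbabilityMeasure (S.symbolicMeasure P i) := by
    unfold symbolicMeasure; infer_instance
  have hmeas := (isClosed_limitSet i).measurableSet
  refine iInf₂_le_of_le _ hmeas (iInf_le_of_le ?_ le_rfl)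
  rw [bernoulli, Measure.map_apply (S.measurable_coding i) hmeas, limitSet_eq_range_coding,
    Set.preimage_range, measure_univ]

end RandomCarpet

/-! ### The dimension formula -/

theorem corollaryA :
    ∃ ε : ℝ, 0 < ε ∧ ∀ S : RandomCarpet, S.Generic →
      (S.NearlyConstant ε ∨ S.NearlyConformal ε) →
      ∃ P : S.weights,
        (∀ Q : S.weights, S.baseDim Q + S.fibreDim Q ≤ S.baseDim P + S.fibreDim P) ∧
        ∀ᵐ i ∂S.envMeasure,
          dimH (S.limitSet i) = measureDimH (S.bernoulli P i) ∧
          measureDimH (S.bernoulli P i) = ENNReal.ofReal (S.baseDim P + S.fibreDim P) := by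
  refine ⟨1, one_pos, fun S _ _ => ?_⟩
  obtain ⟨P, hP⟩ := S.exists_isMax_dim
  refine ⟨P, hP, ?_⟩
  filter_upwards [S.ae_typical] with i hi
  have h1 := RandomCarpet.le_measureDimH_bernoulli hi P
  have h2 := RandomCarpet.measureDimH_bernoulli_le P i
  have h3 := RandomCarpet.dimH_limitSet_le hi
    (add_nonneg (RandomCarpet.baseDim_nonneg P) (RandomCarpet.fibreDim_mem P).1) hP
  exact ⟨le_antisymm (h3.trans h1) h2, le_antisymm (h2.trans h3) h1⟩
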